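/- Let $C$ be a smooth connected projective curve over $\mathbb{C}$ (a compact connected Riemann surface), let $n\ge 1$, and for $i=1,\dots,n$ let $\varphi_i\colon C\to\mathbb{P}^{r_i}$ be an embedding whose image $C_i=\varphi_i(C)$ is contained in no hyperplane. Regard the $\mathbb{P}^{r_i}$ as the skew linear subspaces $\mathbb{P}(\mathbb{C}^{r_i+1})$ of $\mathbb{P}^N=\mathbb{P}\big(\bigoplus_{i=1}^n\mathbb{C}^{r_i+1}\big)$, where $N+1=\sum_i(r_i+1)$. For $p\in C$ put $p_i=\varphi_i(p)$ and $f_p=\langle p_1,\dots,p_n\rangle\cong\mathbb{P}^{n-1}$ (linear span). The decomposable scroll generated by $C_1,\dots,C_n$ is $X=\bigcup_{p\in C}f_p\subset\mathbb{P}^N$; it is a smooth projective variety of dimension $n$. For a non-degenerate $m$-dimensional scroll $Y\subset\mathbb{P}^M$ (a curve if $m=1$) and $x\in Y$, let $\mathrm{Osc}^2_x(Y)\subseteq\mathbb{P}^M$ be the second osculating space, that is, the linear space spanned by the values at $x$ of the partial derivatives of order $\le 2$ of a local holomorphic parametrization of $Y$ in homogeneous coordinates. The inflectional locus $\Phi_2(Y)$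 is the set of those $x\in Y$ at which $\dim\mathrm{Osc}^2_x(Y)$ is smaller than its maximum over $Y$, with the convention that $\Phi_2(Y)=Y$ if $M<2m$ (so every point of a line is a flex of the line). A flex of $Y$ is a point of $\Phi_2(Y)$; "$p_i$ is a flex of $C_i$" refers to $C_i\subset\mathbb{P}^{r_i}$. A hat denotes omission. **Theorem.** Let $p\in C$. (1) The following three conditions are equivalent: (i) $\big(f_p\setminus\bigcup_{i=1}^n\langle p_1,\dots,\widehat{p_i},\dots,p_n\rangle\big)\cap\Phi_2(X)\neq\emptyset$; (ii) $p_i$ is a flex of $C_i$ for every $i=1,\dots,n$; (iii) $f_p\subseteq\Phi_2(X)$. (2) For every $i$, $p_i\in\Phi_2(X)$ if and only if $p_i$ is a flex of $C_i$. (3) Let $x\in\Phi_2(X)$ and $1\le s\le n$. If $x\in f_p\setminus\langle p_1,\dots,\widehat{p_s},\dots,p_n\rangle$, then $p_s$ is a flex of $C_s$. -/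

import Mathlib

open scoped Manifold ContDiff Topology LinearAlgebra.Projectivization

noncomputable section

namespace DecomposableScroll

section Osculation

variable {V : Type*} [NormedAddCommGroup V] [NormedSpace ℂ V]

/-- `F`, a holomorphic germ `(ℂⁿ, 0) → V ∖ {0}`, is a local parametrization at the point `x` of the
`n`-dimensional embedded complex submanifold `Y ⊆ ℙ(V)`, written in homogeneous coordinates: the map
`u ↦ [F u]` sends `0` to `x`, is an immersion at `0`, takes its values in `Y`, and maps
neighbourhoods of `0` onto neighbourhoods of `x` in `Y`. Neighbourhoods in `ℙ(V)` are expressed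
through nonzero vectors of `V` close to `F 0`. -/
structure IsLocalParametrization (n : ℕ) (Y : Set (ℙ ℂ V)) (x : ℙ ℂ V)
    (F : (Fin n → ℂ) → V) : Prop where
  analyticAt : AnalyticAt ℂ F 0
  center : ∃ h : F 0 ≠ 0, Projectivization.mk ℂ (F 0) h = x
  immersion : ∀ (a : ℂ) (u : Fin n → ℂ), a • F 0 + fderiv ℂ F 0 u = 0 → a = 0 ∧ u = 0
  eventually_mem : ∀ᶠ u in 𝓝 (0 : Fin n → ℂ), ∃ h : F u ≠ 0, Projectivization.mk ℂ (F u) h ∈ Y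
  locally_onto : ∀ U ∈ 𝓝 (0 : Fin n → ℂ), ∀ᶠ v in 𝓝 (F 0), ∀ hv : v ≠ 0,
    Projectivization.mk ℂ v hv ∈ Y →
      ∃ u ∈ U, ∃ hu : F u ≠ 0, Projectivization.mk ℂ (F u) hu = Projectivization.mk ℂ v hv

/-- The linear subspace of `V` over the `k`-th osculating space `Osc^k_x(Y) ⊆ ℙ(V)`, for an
`n`-dimensional embedded complex submanifold `Y ⊆ ℙ(V)`: it is spanned by the derivatives of order
`≤ k` at `0` of a local parametrization of `Y` at `x`. Two local parametrizations differ by a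
biholomorphic change of parameters and a nowhere zero holomorphic factor, so all of them give the
same span. Its dimension is the rank of the map from linear forms on `V` to `k`-jets at `x`. -/
def oscSpace (n k : ℕ) (Y : Set (ℙ ℂ V)) (x : ℙ ℂ V) : Submodule ℂ V :=
  Submodule.span ℂ {w | ∃ F : (Fin n → ℂ) → V, IsLocalParametrization n Y x F ∧
    ∃ j ≤ k, ∃ m : Fin j → (Fin n → ℂ), w = iteratedFDeriv ℂ j F 0 m}

/-- The inflectional locus `Φ₂(Y)` of a non-degenerate `n`-dimensional scroll `Y ⊆ ℙ(V) = ℙᴺ`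
(a curve if `n = 1`): the points of `Y` where the dimension of the second osculating space is not
the maximal one. The second osculating spaces of an `n`-dimensional scroll are expected to have
dimension `2n`; if the ambient space is too small for that (`N < 2n`, that is `dim V < 2n + 1`),
then every point of `Y` counts as a point of `Φ₂(Y)`; for example every point of a line is a
flex. -/
def inflectionalLocus (n : ℕ) (Y : Set (ℙ ℂ V)) : Set (ℙ ℂ V) :=
  {x | x ∈ Y ∧ (Module.finrank ℂ V < 2 * n + 1 ∨
    ∃ y ∈ Y, Module.finrank ℂ (oscSpace n 2 Y x) < Module.finrank ℂ (oscSpace n 2 Y y))}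

/-- `φ : C → ℙ(V)` is a non-degenerate holomorphic embedding of the compact Riemann surface `C`:
it is injective, near each point it is given in a chart by a holomorphic map `F` to `V ∖ {0}` with
`F` and `F'` linearly independent at the point (so that it is an immersion), and no hyperplane of
`ℙ(V)` contains its image. Equivalently, `φ` is the map given by a very ample linear system. -/
structure IsNondegenerateEmbedding {C : Type*} [TopologicalSpace C] [ChartedSpace ℂ C]
    (φ : C → ℙ ℂ V) : Prop where
  injective : Function.Injective φ
  holomorphic_immersion : ∀ p : C, ∃ F : ℂ → V, AnalyticAt ℂ F (chartAt ℂ p p) ∧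
    (∀ᶠ z in 𝓝 (chartAt ℂ p p), ∃ h : F z ≠ 0,
      Projectivization.mk ℂ (F z) h = φ ((chartAt ℂ p).symm z)) ∧
    LinearIndependent ℂ ![F (chartAt ℂ p p), deriv F (chartAt ℂ p p)]
  nondegenerate : ⨆ p : C, (φ p).submodule = ⊤

end Osculation

section Scroll

variable {C : Type*} {n : ℕ} {r : Fin n → ℕ}

/-- The point `p_i = φ_i(p)`, regarded as a point of the space `ℙ(⊕_j ℂ^{r_j + 1})` that contains
all the `ℙ^{r_j}` as linear subspaces. -/
def vertex (φ : ∀ i : Fin n, C → ℙ ℂ (Fin (r i + 1) → ℂ)) (p : C) (i : Fin n) :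
    ℙ ℂ (∀ j : Fin n, Fin (r j + 1) → ℂ) :=
  Projectivization.map
    (LinearMap.single ℂ (fun j : Fin n => (Fin (r j + 1) → ℂ)) i)
    (Pi.single_injective (M := fun j : Fin n => (Fin (r j + 1) → ℂ)) i) (φ i p)

/-- The fibre `f_p = ⟨p_1, …, p_n⟩`. -/
def fibre (φ : ∀ i : Fin n, C → ℙ ℂ (Fin (r i + 1) → ℂ)) (p : C) :
    Set (ℙ ℂ (∀ j : Fin n, Fin (r j + 1) → ℂ)) :=
  Projectivization.Subspace.span (Set.range (vertex φ p))

/-- The coordinate hyperplane `⟨p_1, …, p̂_s, …, p_n⟩` of the fibre `f_p`. -/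
def face (φ : ∀ i : Fin n, C → ℙ ℂ (Fin (r i + 1) → ℂ)) (p : C) (s : Fin n) :
    Set (ℙ ℂ (∀ j : Fin n, Fin (r j + 1) → ℂ)) :=
  Projectivization.Subspace.span (vertex φ p '' {i | i ≠ s})

/-- The decomposable scroll generated by the curves `C_i = φ_i(C)`: the union of the fibres. -/
def scroll (φ : ∀ i : Fin n, C → ℙ ℂ (Fin (r i + 1) → ℂ)) :
    Set (ℙ ℂ (∀ j : Fin n, Fin (r j + 1) → ℂ)) :=
  ⋃ p : C, fibre φ p

/-- `p_i` is a flex of the curve `C_i = φ_i(C) ⊆ ℙ^{r_i}`. -/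
def IsFlex (φ : ∀ i : Fin n, C → ℙ ℂ (Fin (r i + 1) → ℂ)) (p : C) (i : Fin n) : Prop :=
  φ i p ∈ inflectionalLocus 1 (Set.range (φ i))

end Scroll

end DecomposableScroll

end

/-! Lift each `φ j` near `p` to a vector function `F j` with `F j`, `F j'` independent. A point of
the fibre is `∑ lam j • F j`, and the scroll is parametrized by moving the base point and all
coefficients except one, `lam s ≠ 0`, which is fixed by scaling. Differentiating up to order two,
the second osculating space is the span of all `F j`, `F j'` together with the single vector `∑ lam
j • F j''` (`oscSpace_eq`). Its linear dimension is thus `2n`, or `2n + 1` exactly when some `lam j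
≠ 0` has `F j''` outside `⟨F j, F j'⟩`, that is, when `p_j` is not a flex.

To see that `2n` is not the maximum: if some `r i ≥ 2`, a non-degenerate curve has a non-flex
(`exists_finrank_oscSpace_eq_three`), and the vertex over it has rank `2n + 1`. If every `r i = 1`,
the ambient vector space has dimension `2n` and the convention applies. Hence a point is inflected
iff `p_j` is a flex for every `j` with nonzero coordinate (`mk_mem_inflectionalLocus_scroll_iff`),
and all three parts are read off from this.

Osculating spaces are compared through their annihilators: a linear form kills the space iff it
vanishes to order three along one parametrization (`mem_dualAnnihilator_oscSpace_iff`), which makes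
any chosen parametrization suffice. -/

noncomputable section

namespace DecomposableScroll

/-! ### Vanishing to order three and second jets -/

section Jets

open Asymptotics

variable {E : Type*} [NormedAddCommGroup E] [NormedSpace ℂ E]

/-- Taylor expansion, with polarization in degree two. The growth condition is the convenient form
because it transfers between parametrizations without differentiating a change of parameters. -/
theorem isBigO_norm_pow_three_iff_iteratedFDeriv_eq_zero {f : E → ℂ} (hf : AnalyticAt ℂ f 0) :
    (f =O[𝓝 0] fun u => ‖u‖ ^ 3) ↔
      ∀ j ≤ 2, ∀ m : Fin j → E, iteratedFDeriv ℂ j f 0 m = 0 := by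
  obtain ⟨p, ρ, hp⟩ := hf
  have htaylor := hp.hasFPowerSeriesAt.isBigO_sub_partialSum_pow
  simp only [zero_add] at htaylor
  constructor
  · intro h
    -- Once the lower terms vanish, the Taylor polynomial is its `j`-th homogeneous term, which is
    -- then `O(‖u‖ ^ (j + 1))` and so zero.
    have hdiag : ∀ j ≤ 2, ∀ y, (p j fun _ => y) = 0 := by
      intro j
      induction j using Nat.strong_induction_on with
      | _ j ih =>
        intro hj y
        refine IsBigO.continuousMultilinearMap_apply_eq_zero ?_ y
        have hsum : p.partialSum (j + 1) = fun y => p j fun _ => y := by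
          funext z
          refine Finset.sum_eq_single _ (fun b hb hbj => ?_)
            fun hn => (hn (Finset.mem_range.mpr (Nat.lt_succ_self j))).elim
          have := Finset.mem_range_succ_iff.mp hb
          exact ih b (by omega) (by omega) z
        have h1 := htaylor (j + 1)
        rw [hsum] at h1
        have h2 : (fun u : E => ‖u‖ ^ 3) =O[𝓝 0] fun u : E => ‖u‖ ^ (j + 1) := by
          refine IsBigO.of_bound 1 ?_
          filter_upwards [Metric.ball_mem_nhds (0 : E) one_pos] with u hu
          rw [mem_ball_zero_iff] at hu
          simpa using pow_le_pow_of_le_one (norm_nonneg u) hu.le (by omega : j + 1 ≤ 3)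
        simpa using (h.trans h2).sub h1
    intro j hj m
    rw [hp.iteratedFDeriv_eq_sum_of_completeSpace]
    obtain rfl | rfl | rfl : j = 0 ∨ j = 1 ∨ j = 2 := by omega
    · simpa [Subsingleton.elim m fun _ => 0] using hdiag 0 (by omega) 0
    · have hm : m = fun _ => m 0 := funext fun i => congrArg m (Subsingleton.elim i 0)
      rw [hm]
      simpa using hdiag 1 (by omega) (m 0)
    -- `p 2` need not be symmetric; the second derivative is its symmetrization, so polarizing the
    -- diagonal is enough.
    · have hexp : ∀ a b : E, p 2 ![a, b] + p 2 ![b, a] = 0 := by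
        intro a b
        have hc : ∀ y : E, p 2 ![y, y] = 0 := fun y => by
          rw [← hdiag 2 le_rfl y]
          congr 1
          ext i
          fin_cases i <;> rfl
        have hab := hc (a + b)
        have e1 : ∀ x y z : E, p 2 ![x + y, z] = p 2 ![x, z] + p 2 ![y, z] := by
          intro x y z
          exact (p 2).cons_add ![z] x y
        have e2 : ∀ x y z : E, p 2 ![z, x + y] = p 2 ![z, x] + p 2 ![z, y] := by
          intro x y z
          have hupd : ∀ t : E, Function.update ![z, 0] 1 t = ![z, t] := fun t => by
            ext i
            fin_cases i <;> rfl
          have := (p 2).map_update_add ![z, 0] 1 x y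
          rwa [hupd, hupd, hupd] at this
        rw [e1, e2, e2, hc, hc, zero_add, add_zero] at hab
        exact hab
      have := hexp (m 0) (m 1)
      rw [← Equiv.sum_comp (Equiv.Perm.decomposeFin (n := 1)).symm, Fintype.sum_prod_type,
        Fin.sum_univ_two]
      simp only [Finset.univ_unique, Finset.sum_singleton]
      convert this using 3 <;>
      · ext i
        fin_cases i <;> simp [Equiv.Perm.decomposeFin]
  · intro h
    have h3 := htaylor 3
    have hsum : p.partialSum 3 = 0 := by
      funext z
      refine Finset.sum_eq_zero fun j hj => ?_
      have h1 := hp.factorial_smul z j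
      rw [h j (by simpa [Nat.lt_succ_iff] using hj)] at h1
      exact (smul_eq_zero.mp h1).resolve_left (Nat.factorial_ne_zero j)
    simpa [hsum] using h3

end Jets

/-! ### Independence of the local parametrization -/

section Independence

open Asymptotics

variable {V : Type*} [NormedAddCommGroup V] [NormedSpace ℂ V] {n : ℕ} {Y : Set (ℙ ℂ V)}
  {x : ℙ ℂ V} {F G : (Fin n → ℂ) → V}

/-- In the affine chart `η ≠ 0` a local parametrization is an immersion. -/
theorem IsLocalParametrization.isBigO_affine (hG : IsLocalParametrization n Y x G)
    (η : V →L[ℂ] ℂ) (hη : η (G 0) ≠ 0) :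
    (fun w : Fin n → ℂ => w) =O[𝓝 0] fun w => (η (G w))⁻¹ • G w - (η (G 0))⁻¹ • G 0 := by
  have hd : HasFDerivAt G (fderiv ℂ G 0) 0 := hG.analyticAt.differentiableAt.hasFDerivAt
  have h1 : HasFDerivAt (fun w => η (G w)) (η ∘L fderiv ℂ G 0) 0 := η.hasFDerivAt.comp 0 hd
  obtain ⟨D, hD, hDu⟩ : ∃ D : (Fin n → ℂ) →L[ℂ] V,
      HasFDerivAt (fun w => (η (G w))⁻¹ • G w) D 0 ∧ ∀ u, D u = (η (G 0))⁻¹ • fderiv ℂ G 0 u +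
        (-(η (G 0) ^ 2)⁻¹ * η (fderiv ℂ G 0 u)) • G 0 := by
    refine ⟨_, ((hasFDerivAt_inv hη).comp 0 h1).fun_smul hd, fun u => ?_⟩
    simp [mul_comm]
  -- A kernel vector `u` of the affine differential makes `fderiv ℂ G 0 u` a multiple of `G 0`,
  -- against `immersion`.
  have hinj : Function.Injective D := by
    rw [injective_iff_map_eq_zero]
    intro u hu
    refine (hG.immersion (η (G 0) * (-(η (G 0) ^ 2)⁻¹ * η (fderiv ℂ G 0 u))) u ?_).2
    have h3 := congrArg (fun v => η (G 0) • v) hu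
    simp only [hDu, smul_add, smul_zero, smul_smul, mul_inv_cancel₀ hη, one_smul] at h3
    rw [add_comm]
    exact h3
  have hind : Topology.IsInducing D := by
    obtain ⟨K, -, hK⟩ := LinearMap.exists_antilipschitzWith D.toLinearMap
      (LinearMap.ker_eq_bot.mpr hinj)
    exact (hK.isUniformInducing D.uniformContinuous).isInducing
  simpa using (hD.isTheta_sub hind).isBigO_symm

/-- No holomorphic transition map is constructed: each `[F u]` equals some `[G w]`, and `‖w‖ =
O(‖u‖)` since in the chart `η ≠ 0` the map `G` is bounded below by `‖w‖` and `F` above by `‖u‖`. -/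
theorem IsLocalParametrization.isBigO_comp (hG : IsLocalParametrization n Y x G)
    (hF : IsLocalParametrization n Y x F) (ℓ : V →L[ℂ] ℂ) {k : ℕ}
    (h : (fun w => ℓ (G w)) =O[𝓝 0] fun w => ‖w‖ ^ k) :
    (fun u => ℓ (F u)) =O[𝓝 0] fun u => ‖u‖ ^ k := by
  obtain ⟨hG0, hGx⟩ := hG.center
  obtain ⟨hF0, hFx⟩ := hF.center
  obtain ⟨a, ha⟩ := (Projectivization.mk_eq_mk_iff' ℂ _ _ hF0 hG0).mp (hFx.trans hGx.symm)
  have ha0 : a ≠ 0 := by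
    rintro rfl
    exact hF0 (by simpa using ha.symm)
  obtain ⟨η, -, hη⟩ := exists_dual_vector ℂ (G 0) (norm_ne_zero_iff.mpr hG0)
  have hηG : η (G 0) ≠ 0 := by
    rw [hη]
    simpa using hG0
  have hηF : η (F 0) ≠ 0 := by
    rw [← ha]
    simpa using ⟨ha0, hηG⟩
  have hFc := hF.analyticAt.continuousAt
  have hGc := hG.analyticAt.continuousAt
  obtain ⟨K, hK⟩ := (hG.isBigO_affine η hηG).bound
  obtain ⟨M, hM⟩ := h.bound
  have hFd : DifferentiableAt ℂ (fun u => (η (F u))⁻¹ • F u) 0 := by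
    have := hF.analyticAt.differentiableAt
    have h1 : DifferentiableAt ℂ (fun u => η (F u)) 0 := η.differentiableAt.comp 0 this
    exact (h1.inv hηF).smul this
  have hFO := hFd.hasFDerivAt.isBigO_sub
  obtain ⟨K', hK'⟩ := hFO.bound
  have hGinv : ContinuousAt (fun w => (η (G w))⁻¹) 0 :=
    ContinuousAt.inv₀ (η.continuous.continuousAt.comp hGc) hηG
  have hbdd : ∀ᶠ w in 𝓝 (0 : Fin n → ℂ), ‖(η (G w))⁻¹‖ < ‖(η (G 0))⁻¹‖ + 1 :=
    hGinv.norm.eventually_lt continuousAt_const (lt_add_one _)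
  have hGne : ∀ᶠ w in 𝓝 (0 : Fin n → ℂ), η (G w) ≠ 0 :=
    (η.continuous.continuousAt.comp hGc).eventually_ne hηG
  have hU := Filter.inter_mem (Filter.inter_mem hK hM) (Filter.inter_mem hbdd hGne)
  have honto := hG.locally_onto _ hU
  -- `locally_onto` concerns vectors near `G 0`, whereas `F 0` is only proportional to it.
  have hFa : Filter.Tendsto (fun u => a⁻¹ • F u) (𝓝 0) (𝓝 (G 0)) := by
    have : Filter.Tendsto (fun u => a⁻¹ • F u) (𝓝 0) (𝓝 (a⁻¹ • F 0)) :=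
      hFc.tendsto.const_smul a⁻¹
    rwa [← ha, inv_smul_smul₀ ha0] at this
  have haff : (fun u => ℓ ((η (F u))⁻¹ • F u)) =O[𝓝 0] fun u => ‖u‖ ^ k := by
    refine IsBigO.of_bound ((‖(η (G 0))⁻¹‖ + 1) * (|M| * (|K| * |K'|) ^ k)) ?_
    filter_upwards [hFa.eventually honto, hF.eventually_mem, hK'] with u hu hmem hu'
    obtain ⟨hFu, hFuY⟩ := hmem
    have hsc : Projectivization.mk ℂ (a⁻¹ • F u) (smul_ne_zero (inv_ne_zero ha0) hFu) =
        Projectivization.mk ℂ (F u) hFu :=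
      (Projectivization.mk_eq_mk_iff' ℂ _ _ _ _).mpr ⟨a⁻¹, rfl⟩
    obtain ⟨w, ⟨⟨hwK, hwM⟩, hwb, hwne⟩, hGw, hw⟩ := hu (smul_ne_zero (inv_ne_zero ha0) hFu)
      (by rwa [hsc])
    obtain ⟨c, hc⟩ := (Projectivization.mk_eq_mk_iff' ℂ _ _ hGw hFu).mp (hw.trans hsc)
    have hc0 : c ≠ 0 := by
      rintro rfl
      exact hGw (by simpa using hc.symm)
    simp only [Set.mem_ofPred_eq] at hwK hwM hwb hwne
    -- Normalizing by `η` removes the scalar `c`, which is not controlled.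
    have heq : (η (F u))⁻¹ • F u = (η (G w))⁻¹ • G w := by
      rw [← hc, map_smul, smul_eq_mul, smul_smul, mul_inv, mul_right_comm, inv_mul_cancel₀ hc0,
        one_mul]
    have heq0 : (η (F 0))⁻¹ • F 0 = (η (G 0))⁻¹ • G 0 := by
      rw [← ha, map_smul, smul_eq_mul, smul_smul, mul_inv, mul_right_comm, inv_mul_cancel₀ ha0,
        one_mul]
    rw [heq, heq0] at hu'
    have hwu : ‖w‖ ≤ |K| * |K'| * ‖u‖ := by
      calc ‖w‖ ≤ K * ‖(η (G w))⁻¹ • G w - (η (G 0))⁻¹ • G 0‖ := hwK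
        _ ≤ |K| * ‖(η (G w))⁻¹ • G w - (η (G 0))⁻¹ • G 0‖ := by gcongr; exact le_abs_self K
        _ ≤ |K| * (K' * ‖u - 0‖) := by gcongr
        _ ≤ |K| * (|K'| * ‖u‖) := by rw [sub_zero]; gcongr; exact le_abs_self K'
        _ = _ := by ring
    rw [heq, map_smul, smul_eq_mul, norm_mul]
    simp only [norm_pow, norm_norm] at hwM ⊢
    calc ‖(η (G w))⁻¹‖ * ‖ℓ (G w)‖ ≤ (‖(η (G 0))⁻¹‖ + 1) * (|M| * (|K| * |K'| * ‖u‖) ^ k) := by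
          gcongr
          exact hwM.trans (by gcongr; exact le_abs_self M)
      _ = _ := by ring
  have hmul : (fun u => η (F u) * ℓ ((η (F u))⁻¹ • F u)) =O[𝓝 0] fun u => (1 : ℝ) * ‖u‖ ^ k :=
    ((η.continuous.continuousAt.comp hFc).isBigO_one ℝ).mul haff
  simp only [one_mul] at hmul
  refine hmul.congr' ?_ Filter.EventuallyEq.rfl
  filter_upwards [(η.continuous.continuousAt.comp hFc).eventually_ne hηF] with u hu
  have hu : η (F u) ≠ 0 := hu
  rw [map_smul, smul_eq_mul, mul_inv_cancel_left₀ hu]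

/-- A linear form vanishes on the second osculating space if and only if it vanishes to order
three along a local parametrization. -/
theorem IsLocalParametrization.mem_dualAnnihilator_oscSpace_iff [FiniteDimensional ℂ V]
    (hG : IsLocalParametrization n Y x G) (ℓ : Module.Dual ℂ V) :
    ℓ ∈ (oscSpace n 2 Y x).dualAnnihilator ↔
      (fun w => ℓ (G w)) =O[𝓝 0] fun w => ‖w‖ ^ 3 := by
  set ℓ' : V →L[ℂ] ℂ := LinearMap.toContinuousLinearMap ℓ with hℓ'
  have hjet : ∀ F : (Fin n → ℂ) → V, AnalyticAt ℂ F 0 →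
      (((fun w => ℓ (F w)) =O[𝓝 0] fun w => ‖w‖ ^ 3) ↔
        ∀ j ≤ 2, ∀ m : Fin j → (Fin n → ℂ), ℓ (iteratedFDeriv ℂ j F 0 m) = 0) := by
    intro F hF
    have h1 : AnalyticAt ℂ (fun w => ℓ (F w)) 0 := (ℓ'.analyticAt _).comp hF
    rw [isBigO_norm_pow_three_iff_iteratedFDeriv_eq_zero h1]
    refine forall₃_congr fun j hj m => ?_
    have := ℓ'.iteratedFDeriv_comp_left (n := ω) hF.contDiffAt (i := j) le_top
    have h2 := congrArg (fun T => T m) this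
    change iteratedFDeriv ℂ j (fun w => ℓ (F w)) 0 m = ℓ (iteratedFDeriv ℂ j F 0 m) at h2
    rw [h2]
  rw [Submodule.mem_dualAnnihilator]
  constructor
  · intro h
    rw [hjet G hG.analyticAt]
    exact fun j hj m => h _ (Submodule.subset_span ⟨G, hG, j, hj, m, rfl⟩)
  · intro h w hw
    induction hw using Submodule.span_induction with
    | mem w hw =>
      obtain ⟨F, hF, j, hj, m, rfl⟩ := hw
      exact (hjet F hF.analyticAt).mp (hG.isBigO_comp hF ℓ' h) j hj m
    | zero => simp
    | add _ _ _ _ h1 h2 => rw [map_add, h1, h2, add_zero]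
    | smul c _ _ h1 => rw [map_smul, h1, smul_zero]

end Independence

/-! ### The second jet in scroll coordinates -/

section QuadraticJets

open Asymptotics

/-- Let `t` tend to `0` to get `A = 0`, then divide by `t`. Iterating peels off Taylor coefficients
one at a time. -/
theorem eq_zero_and_isBigO_of_add_mul {A b : ℂ} {g : ℂ → ℂ} {k : ℕ}
    (hg : Filter.Tendsto g (𝓝[≠] 0) (𝓝 b))
    (h : (fun t => A + t * g t) =O[𝓝[≠] 0] fun t => ‖t‖ ^ (k + 1)) :
    A = 0 ∧ g =O[𝓝[≠] 0] fun t => ‖t‖ ^ k := by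
  have hid : Filter.Tendsto (fun t : ℂ => t) (𝓝[≠] 0) (𝓝 0) := nhdsWithin_le_nhds
  have hA : A = 0 := by
    have h1 : Filter.Tendsto (fun t => A + t * g t) (𝓝[≠] 0) (𝓝 (A + 0 * b)) :=
      tendsto_const_nhds.add (hid.mul hg)
    have h2 : Filter.Tendsto (fun t : ℂ => ‖t‖ ^ (k + 1)) (𝓝[≠] 0) (𝓝 0) := by
      simpa using (hid.norm.pow (k + 1))
    simpa using tendsto_nhds_unique h1 (h.trans_tendsto h2)
  subst hA
  refine ⟨rfl, ?_⟩
  obtain ⟨c, hc⟩ := h.bound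
  refine IsBigO.of_bound c ?_
  filter_upwards [hc, self_mem_nhdsWithin] with t ht ht0
  have ht0 : 0 < ‖t‖ := norm_pos_iff.mpr ht0
  rw [zero_add, norm_mul, norm_pow, norm_norm, pow_succ] at ht
  rw [norm_pow, norm_norm]
  refine le_of_mul_le_mul_left ?_ ht0
  linarith

variable {n : ℕ}

/-- The second jet of the linear forms `∑ j, (lam j + u j) * f j (u s)` with `f j` a function of one
variable with jet `(a j, b j, c j)`. -/
theorem isBigO_norm_pow_three_iff_jet_eq_zero {lam a b c : Fin n → ℂ} {R : Fin n → ℂ → ℂ}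
    (hR : ∀ j, ContinuousAt (R j) 0) {s : Fin n} (hs : lam s ≠ 0) :
    ((fun u : Fin n → ℂ => ∑ j, (lam j + if j = s then 0 else u j) *
        (a j + u s * b j + u s ^ 2 / 2 * c j + u s ^ 3 * R j (u s))) =O[𝓝 0]
          fun u => ‖u‖ ^ 3) ↔
      (∀ j, a j = 0) ∧ (∀ j, b j = 0) ∧ ∑ j, lam j * c j = 0 := by
  constructor
  · intro h
    -- Restrict to the line `t ↦ t • α'`, with `α'` equal to `α` except for a `1` in position `s`,
    -- and read the coefficients of `1`, `t`, `t ^ 2`.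
    have key : ∀ α : Fin n → ℂ, α s = 0 →
        ∑ j, lam j * a j = 0 ∧ ∑ j, (lam j * b j + α j * a j) = 0 ∧
          ∑ j, (lam j * c j / 2 + α j * b j) = 0 := by
      intro α hα
      have hcurve : ContinuousAt (fun t : ℂ => t • Function.update α s 1) 0 := by fun_prop
      have hlim : Filter.Tendsto (fun t : ℂ => t • Function.update α s 1) (𝓝[≠] 0) (𝓝 0) := by
        have := hcurve.tendsto
        rw [zero_smul] at this
        exact this.mono_left nhdsWithin_le_nhds
      have h1 := h.comp_tendsto hlim
      have h2 : ((fun u : Fin n → ℂ => ‖u‖ ^ 3) ∘ fun t : ℂ => t • Function.update α s 1)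
          =O[𝓝[≠] 0] fun t => ‖t‖ ^ (2 + 1) := by
        refine IsBigO.of_bound (‖Function.update α s 1‖ ^ 3) (Filter.Eventually.of_forall fun t => ?_)
        simp only [Function.comp_apply, norm_smul, norm_pow, norm_mul, norm_norm]
        rw [mul_pow, mul_comm]
      have h3 := h1.trans h2
      set g : ℂ → ℂ := fun t => ∑ j, (α j * c j / 2 + (lam j + t * α j) * R j t) with hg
      have hgc : Filter.Tendsto g (𝓝[≠] 0) (𝓝 (g 0)) := by
        have : ContinuousAt g 0 := by
          rw [hg]
          refine tendsto_finsetSum _ fun j _ => ?_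
          exact continuousAt_const.add
            ((continuousAt_const.add (continuousAt_id.mul continuousAt_const)).mul (hR j))
        exact this.tendsto.mono_left nhdsWithin_le_nhds
      have hid : Filter.Tendsto (fun t : ℂ => t) (𝓝[≠] 0) (𝓝 0) := nhdsWithin_le_nhds
      have h4 : (fun t => (∑ j, lam j * a j) + t * ((∑ j, (lam j * b j + α j * a j)) +
          t * ((∑ j, (lam j * c j / 2 + α j * b j)) + t * g t))) =O[𝓝[≠] 0]
            fun t => ‖t‖ ^ (2 + 1) := by
        refine h3.congr_left fun t => ?_
        simp only [Function.comp_apply, hg, Finset.mul_sum, ← Finset.sum_add_distrib]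
        refine Finset.sum_congr rfl fun j _ => ?_
        by_cases hj : j = s
        · subst hj
          simp [hα]
          ring
        · simp [hj]
          ring
      have hadd : ∀ (x : ℂ) {f : ℂ → ℂ} {y : ℂ}, Filter.Tendsto f (𝓝[≠] 0) (𝓝 y) →
          Filter.Tendsto (fun t => x + t * f t) (𝓝[≠] 0) (𝓝 (x + 0 * y)) :=
        fun x _ _ hf => tendsto_const_nhds.add (hid.mul hf)
      obtain ⟨e1, h5⟩ := eq_zero_and_isBigO_of_add_mul (hadd _ (hadd _ hgc)) h4
      obtain ⟨e2, h6⟩ := eq_zero_and_isBigO_of_add_mul (hadd _ hgc) h5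
      obtain ⟨e3, -⟩ := eq_zero_and_isBigO_of_add_mul hgc h6
      exact ⟨e1, e2, e3⟩
    obtain ⟨ha0, hb0, hc0⟩ := key 0 rfl
    simp only [Pi.zero_apply, zero_mul, add_zero] at hb0 hc0
    -- Comparing `α = e_j` with `α = 0` isolates `a j` and `b j`; index `s` is recovered afterwards
    -- from `lam s ≠ 0`.
    have hab : ∀ j ≠ s, a j = 0 ∧ b j = 0 := by
      intro j hj
      obtain ⟨-, h1, h2⟩ := key (Pi.single j 1) (Pi.single_eq_of_ne (Ne.symm hj) 1)
      simp only [Finset.sum_add_distrib, hb0, hc0, zero_add, Pi.single_apply, ite_mul, one_mul,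
        zero_mul, Finset.sum_ite_eq', Finset.mem_univ, if_true] at h1 h2
      exact ⟨h1, h2⟩
    have has : a s = 0 := by
      rw [Finset.sum_eq_single s (fun j _ hj => by rw [(hab j hj).1, mul_zero])
        (fun h => (h (Finset.mem_univ s)).elim)] at ha0
      exact (mul_eq_zero.mp ha0).resolve_left hs
    have hbs : b s = 0 := by
      rw [Finset.sum_eq_single s (fun j _ hj => by rw [(hab j hj).2, mul_zero])
        (fun h => (h (Finset.mem_univ s)).elim)] at hb0
      exact (mul_eq_zero.mp hb0).resolve_left hs
    refine ⟨fun j => ?_, fun j => ?_, ?_⟩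
    · by_cases hj : j = s
      · rw [hj, has]
      · exact (hab j hj).1
    · by_cases hj : j = s
      · rw [hj, hbs]
      · exact (hab j hj).2
    · rw [← Finset.sum_div, div_eq_zero_iff] at hc0
      exact hc0.resolve_right two_ne_zero
  · rintro ⟨ha, hb, hc⟩
    have hcoord : ∀ j : Fin n, (fun u : Fin n → ℂ => u j) =O[𝓝 0] fun u => ‖u‖ := fun j =>
      IsBigO.of_bound 1 (Filter.Eventually.of_forall fun u => by simpa using norm_le_pi_norm u j)
    have hcoord' : ∀ j : Fin n, (fun u : Fin n → ℂ => if j = s then 0 else u j) =O[𝓝 0]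
        fun u => ‖u‖ := fun j => by
      by_cases hj : j = s
      · simpa [hj] using isBigO_zero _ _
      · simpa [hj] using hcoord j
    -- The only quadratic term left is `u s ^ 2 / 2 * ∑ lam j * c j`, which vanishes; what remains
    -- is cubic.
    have hsum : ∀ u : Fin n → ℂ, ∑ j, (lam j + if j = s then 0 else u j) *
        (a j + u s * b j + u s ^ 2 / 2 * c j + u s ^ 3 * R j (u s)) =
        ∑ j, (((if j = s then 0 else u j) * u s ^ 2) * (c j / 2) + u s ^ 3 *
          ((lam j + if j = s then 0 else u j) * R j (u s))) := by
      intro u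
      have h1 : ∑ j, u s ^ 2 / 2 * (lam j * c j) = 0 := by
        rw [← Finset.mul_sum, hc, mul_zero]
      rw [← sub_zero (∑ j, (lam j + _) * _), ← h1, ← Finset.sum_sub_distrib]
      refine Finset.sum_congr rfl fun j _ => ?_
      rw [ha, hb]
      ring
    simp only [hsum]
    refine IsBigO.fun_sum fun j _ => IsBigO.add ?_ ?_
    · have h2 : (fun u : Fin n → ℂ => c j / 2) =O[𝓝 0] fun _ => (1 : ℝ) :=
        isBigO_const_const _ one_ne_zero _
      refine (((hcoord' j).mul ((hcoord s).pow 2)).mul h2).congr_right fun u => ?_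
      ring
    · have hcs : ContinuousAt (fun u : Fin n → ℂ => u s) 0 := (continuous_apply s).continuousAt
      have hRc : ContinuousAt (fun u : Fin n → ℂ => R j (u s)) 0 :=
        ContinuousAt.comp (f := fun u : Fin n → ℂ => u s) (hR j) hcs
      have hlc : ContinuousAt (fun u : Fin n → ℂ => lam j + if j = s then 0 else u j) 0 := by
        by_cases hj : j = s
        · simpa [hj] using continuousAt_const
        · simp only [hj, if_false]
          exact continuousAt_const.add (continuous_apply j).continuousAt
      refine (((hcoord s).pow 3).mul ((hlc.mul hRc).isBigO_one ℝ)).congr_right fun u => ?_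
      ring

end QuadraticJets

/-! ### Holomorphic lifts of a curve -/

section Parametrization

variable {C : Type*} [TopologicalSpace C]

/-- `F` is a holomorphic lift of `φ` near the point with coordinate `z` in the chart `e`, and an
immersion there. -/
structure IsLocalLift {V : Type*} [NormedAddCommGroup V] [NormedSpace ℂ V]
    (e : OpenPartialHomeomorph C ℂ) (φ : C → ℙ ℂ V) (F : ℂ → V) (z : ℂ) : Prop where
  mem_target : z ∈ e.target
  analyticAt : AnalyticAt ℂ F z
  eventually_mk : ∀ᶠ w in 𝓝 z, ∃ h : F w ≠ 0, Projectivization.mk ℂ (F w) h = φ (e.symm w)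
  linearIndependent : LinearIndependent ℂ ![F z, deriv F z]

namespace IsLocalLift

variable {V : Type*} [NormedAddCommGroup V] [NormedSpace ℂ V]
  {e : OpenPartialHomeomorph C ℂ} {φ : C → ℙ ℂ V} {F : ℂ → V} {z : ℂ}

theorem ne_zero (h : IsLocalLift e φ F z) : F z ≠ 0 :=
  h.linearIndependent.ne_zero 0

theorem submodule_eq (h : IsLocalLift e φ F z) :
    (φ (e.symm z)).submodule = Submodule.span ℂ {F z} := by
  obtain ⟨h0, h1⟩ := h.eventually_mk.self_of_nhds
  rw [← h1, Projectivization.submodule_mk]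

theorem eventually [CompleteSpace V] (h : IsLocalLift e φ F z) : ∀ᶠ w in 𝓝 z, IsLocalLift e φ F w := by
  have hli : ∀ᶠ w in 𝓝 z, LinearIndependent ℂ ![F w, deriv F w] := by
    have hc : ContinuousAt (fun w => ![F w, deriv F w]) z := by
      rw [continuousAt_pi]
      intro i
      fin_cases i
      · exact h.analyticAt.continuousAt
      · exact h.analyticAt.deriv.continuousAt
    exact hc.eventually h.linearIndependent.eventually
  filter_upwards [e.open_target.mem_nhds h.mem_target, h.analyticAt.eventually_analyticAt,
    h.eventually_mk.eventually_nhds, hli] with w h1 h2 h3 h4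
  exact ⟨h1, h2, h3, h4⟩

theorem eventually_source (h : IsLocalLift e φ F z) : ∀ᶠ q in 𝓝 (e.symm z), q ∈ e.source ∧
    F (e q) ≠ 0 ∧ (φ q).submodule = Submodule.span ℂ {F (e q)} := by
  have hs : e.symm z ∈ e.source := e.map_target h.mem_target
  have hc := (e.continuousAt hs).tendsto
  rw [e.right_inv h.mem_target] at hc
  filter_upwards [e.open_source.mem_nhds hs, hc.eventually h.eventually_mk] with q h1 h2
  obtain ⟨h3, h4⟩ := h2
  refine ⟨h1, h3, ?_⟩
  rw [e.left_inv h1] at h4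
  rw [← h4, Projectivization.submodule_mk]

theorem continuousAt_comp (h : IsLocalLift e φ F z) :
    ContinuousAt (fun q => F (e q)) (e.symm z) := by
  have hs : e.symm z ∈ e.source := e.map_target h.mem_target
  refine ContinuousAt.comp (g := F) ?_ (e.continuousAt hs)
  rw [e.right_inv h.mem_target]
  exact h.analyticAt.continuousAt

/-- Linear independence of `F` and `w` is an open condition. This later keeps points of the scroll
near `v₀` away from distant fibres. -/
theorem eventually_notMem_submodule (h : IsLocalLift e φ F z) {w : V}
    (hw : w ∉ (φ (e.symm z)).submodule) :
    ∀ᶠ y : V × C in 𝓝 (w, e.symm z), y.1 ∉ (φ y.2).submodule := by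
  have hli : LinearIndependent ℂ ![F z, w] := by
    rw [LinearIndependent.pair_iff' h.ne_zero]
    intro a ha
    apply hw
    rw [h.submodule_eq]
    exact Submodule.mem_span_singleton.mpr ⟨a, ha⟩
  have hc : ContinuousAt (fun y : V × C => ![F (e y.2), y.1]) (w, e.symm z) := by
    rw [continuousAt_pi]
    intro i
    fin_cases i
    · exact ContinuousAt.comp (f := Prod.snd) (x := (w, e.symm z)) h.continuousAt_comp
        continuousAt_snd
    · exact continuousAt_fst
  have hli' : ∀ᶠ y : V × C in 𝓝 (w, e.symm z), LinearIndependent ℂ ![F (e y.2), y.1] := by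
    have h1 : ∀ᶠ g in 𝓝 ![F (e (e.symm z)), w], LinearIndependent ℂ g := by
      rw [e.right_inv h.mem_target]
      exact hli.eventually
    exact hc.eventually h1
  have hs : ∀ᶠ y : V × C in 𝓝 (w, e.symm z), _ :=
    (continuous_snd.tendsto (w, e.symm z)).eventually h.eventually_source
  filter_upwards [hli', hs] with y hy ⟨_, h2, h3⟩ hmem
  rw [h3] at hmem
  obtain ⟨a, ha⟩ := Submodule.mem_span_singleton.mp hmem
  exact (LinearIndependent.pair_iff' h2).mp hy a ha

end IsLocalLift

end Parametrization

theorem submodule_eq_span_singleton {K V : Type*} [DivisionRing K] [AddCommGroup V] [Module K V]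
    {x : ℙ K V} {w : V} (hw : w ≠ 0) (h : w ∈ x.submodule) : x.submodule = Submodule.span K {w} := by
  rw [Projectivization.submodule_eq] at h ⊢
  obtain ⟨a, ha⟩ := Submodule.mem_span_singleton.mp h
  have ha0 : a ≠ 0 := by
    rintro rfl
    exact hw (by simpa using ha.symm)
  rw [← ha, Submodule.span_singleton_smul_eq (IsUnit.mk0 a ha0)]

theorem mk_mem_range_iff {K V C : Type*} [DivisionRing K] [AddCommGroup V] [Module K V] {φ : C → ℙ K V}
    {v : V} (hv : v ≠ 0) :
    Projectivization.mk K v hv ∈ Set.range φ ↔ ∃ q, v ∈ (φ q).submodule := by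
  refine exists_congr fun q => ⟨fun h => ?_, fun h => ?_⟩
  · rw [h, Projectivization.submodule_mk]
    exact Submodule.mem_span_singleton_self v
  · apply Projectivization.submodule_injective
    rw [submodule_eq_span_singleton hv h, Projectivization.submodule_mk]

/-! ### Local parametrization of a scroll -/

section AbstractScroll

open Asymptotics

variable {C : Type*} [TopologicalSpace C] {n : ℕ} {E : Fin n → Type*}
  [∀ j, NormedAddCommGroup (E j)] [∀ j, NormedSpace ℂ (E j)]
  {V : Type*} [NormedAddCommGroup V] [NormedSpace ℂ V]

/-- In homogeneous coordinates, the parametrization `u ↦ ∑ j, (lam j + u j) F j (z + u s)` of a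
decomposable scroll near the point `∑ j, lam j F j z`; here `u s` is the parameter on the base. -/
def scrollParam (L : V ≃L[ℂ] ∀ j, E j) (F : ∀ j, ℂ → E j) (z : ℂ) (lam : Fin n → ℂ) (s : Fin n)
    (u : Fin n → ℂ) : V :=
  L.symm fun j => (lam j + if j = s then 0 else u j) • F j (z + u s)

variable {L : V ≃L[ℂ] ∀ j, E j} {φ : ∀ j, C → ℙ ℂ (E j)} {e : OpenPartialHomeomorph C ℂ}
  {F : ∀ j, ℂ → E j} {z : ℂ} {lam : Fin n → ℂ} {s : Fin n}

theorem scrollParam_zero : scrollParam L F z lam s 0 = L.symm fun j => lam j • F j z := by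
  simp [scrollParam]

theorem apply_scrollParam (u : Fin n → ℂ) (j : Fin n) :
    L (scrollParam L F z lam s u) j = (lam j + if j = s then 0 else u j) • F j (z + u s) := by
  simp [scrollParam]

theorem analyticAt_scrollParam (hF : ∀ j, AnalyticAt ℂ (F j) z) :
    AnalyticAt ℂ (scrollParam L F z lam s) 0 := by
  refine (L.symm.toContinuousLinearMap.analyticAt _).comp
    (f := fun u : Fin n → ℂ => fun j => (lam j + if j = s then 0 else u j) • F j (z + u s)) ?_
  refine AnalyticAt.pi fun j => ?_
  have hcoord : ∀ i : Fin n, AnalyticAt ℂ (fun u : Fin n → ℂ => u i) 0 := fun i =>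
    (ContinuousLinearMap.proj (R := ℂ) (φ := fun _ : Fin n => ℂ) i).analyticAt 0
  refine AnalyticAt.smul ?_ ?_
  · refine analyticAt_const.add ?_
    by_cases hj : j = s
    · simpa [hj] using analyticAt_const
    · simpa [hj] using hcoord j
  · refine AnalyticAt.comp (g := F j) (f := fun u : Fin n → ℂ => z + u s) ?_
      (analyticAt_const.add (hcoord s))
    simpa using hF j

theorem apply_fderiv_scrollParam (hF : ∀ j, AnalyticAt ℂ (F j) z) (u : Fin n → ℂ) (j : Fin n) :
    L (fderiv ℂ (scrollParam L F z lam s) 0 u) j =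
      (if j = s then 0 else u j) • F j z + (lam j * u s) • deriv (F j) z := by
  have h1 : HasFDerivAt (fun u => L (scrollParam L F z lam s u) j) _ 0 :=
    ((ContinuousLinearMap.proj (R := ℂ) (φ := E) j).comp L.toContinuousLinearMap).hasFDerivAt.comp 0
      (analyticAt_scrollParam (L := L) (lam := lam) (s := s) hF).differentiableAt.hasFDerivAt
  have hline : HasDerivAt (fun t : ℂ => t • u) u 0 := by
    simpa using (hasDerivAt_id (0 : ℂ)).smul_const u
  rw [← zero_smul ℂ u] at h1
  have h2 := h1.comp_hasDerivAt (0 : ℂ) hline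
  have h3 : HasDerivAt (fun t : ℂ => lam j + if j = s then 0 else t * u j)
      (if j = s then 0 else u j) 0 := by
    by_cases hj : j = s
    · simpa [hj] using hasDerivAt_const (0 : ℂ) (lam s)
    · simpa [hj] using ((hasDerivAt_id (0 : ℂ)).mul_const (u j)).const_add (lam j)
  have h4 : HasDerivAt (fun t : ℂ => F j (z + t * u s)) (u s • deriv (F j) z) 0 := by
    refine HasDerivAt.scomp (h := fun t : ℂ => z + t * u s) (0 : ℂ) ?_ ?_
    · simpa using (hF j).differentiableAt.hasDerivAt
    · simpa using ((hasDerivAt_id (0 : ℂ)).mul_const (u s)).const_add z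
  have h5 := h3.fun_smul h4
  have heq : (fun u => L (scrollParam L F z lam s u) j) ∘ (fun t : ℂ => t • u) =
      fun t : ℂ => (lam j + if j = s then 0 else t * u j) • F j (z + t * u s) := by
    funext t
    simp [apply_scrollParam]
  rw [heq] at h2
  have h6 := h2.unique h5
  simp only [zero_smul] at h6
  simp only [ContinuousLinearMap.comp_apply, ContinuousLinearMap.proj_apply] at h6
  refine h6.trans ?_
  simp [smul_smul, add_comm]

/-- The immersion property comes from independence of `F j`, `F j'` in each summand. Local
surjectivity is the global point: compactness of `C` and injectivity of `φ s` force nearby points of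
`Y` to lie over nearby base points. -/
theorem isLocalParametrization_scrollParam [CompactSpace C] (hF : ∀ j, IsLocalLift e (φ j) (F j) z)
    (hinj : ∀ j, Function.Injective (φ j))
    (hlift : ∀ j q, ∃ (e' : OpenPartialHomeomorph C ℂ) (F' : ℂ → E j) (z' : ℂ),
      IsLocalLift e' (φ j) F' z' ∧ e'.symm z' = q)
    {Y : Set (ℙ ℂ V)}
    (hY : ∀ v (hv : v ≠ 0), Projectivization.mk ℂ v hv ∈ Y ↔
      ∃ q, ∀ j, L v j ∈ (φ j q).submodule)
    (hs : lam s ≠ 0) {v₀ : V} (hv₀ : v₀ ≠ 0) (hLv₀ : ∀ j, L v₀ j = lam j • F j z) :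
    IsLocalParametrization n Y (Projectivization.mk ℂ v₀ hv₀) (scrollParam L F z lam s) := by
  set G := scrollParam L F z lam s with hG
  have hFa : ∀ j, AnalyticAt ℂ (F j) z := fun j => (hF j).analyticAt
  have hGa : AnalyticAt ℂ G 0 := analyticAt_scrollParam hFa
  have hG0 : G 0 = v₀ := by
    apply L.injective
    rw [hG, scrollParam_zero, L.apply_symm_apply]
    exact (funext hLv₀).symm
  refine ⟨hGa, ⟨hG0 ▸ hv₀, by simp only [hG0]⟩, ?_, ?_, ?_⟩
  · intro a u h
    have hj : ∀ j, (a * lam j + if j = s then 0 else u j) • F j z +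
        (lam j * u s) • deriv (F j) z = 0 := by
      intro j
      have h1 := congrFun (congrArg L h) j
      rw [map_add, map_smul, map_zero, hG0, Pi.add_apply, Pi.smul_apply, hLv₀,
        apply_fderiv_scrollParam hFa, Pi.zero_apply] at h1
      rw [← h1, add_smul, smul_smul, add_assoc]
    have hpair : ∀ j, (a * lam j + if j = s then 0 else u j) = 0 ∧ lam j * u s = 0 := fun j =>
      LinearIndependent.pair_iff.mp (hF j).linearIndependent _ _ (hj j)
    have hus : u s = 0 := (mul_eq_zero.mp (hpair s).2).resolve_left hs
    have ha : a = 0 := by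
      have := (hpair s).1
      rw [if_pos rfl, add_zero] at this
      exact (mul_eq_zero.mp this).resolve_right hs
    refine ⟨ha, funext fun j => ?_⟩
    by_cases hjs : j = s
    · rw [hjs, hus, Pi.zero_apply]
    · have := (hpair j).1
      rwa [if_neg hjs, ha, zero_mul, zero_add] at this
  · have hne : ∀ᶠ u in 𝓝 (0 : Fin n → ℂ), G u ≠ 0 :=
      hGa.continuousAt.eventually_ne (hG0 ▸ hv₀)
    have hc : Filter.Tendsto (fun u : Fin n → ℂ => z + u s) (𝓝 0) (𝓝 z) := by
      have : Continuous fun u : Fin n → ℂ => z + u s := by fun_prop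
      simpa using this.tendsto 0
    have hmk := hc.eventually (Filter.eventually_all.mpr fun j => (hF j).eventually_mk)
    filter_upwards [hne, hmk] with u hu hmku
    refine ⟨hu, (hY _ hu).mpr ⟨e.symm (z + u s), fun j => ?_⟩⟩
    obtain ⟨h0, h1⟩ := hmku j
    rw [← h1, Projectivization.submodule_mk, apply_scrollParam]
    exact Submodule.smul_mem _ _ (Submodule.mem_span_singleton_self _)
  · intro U hU
    rw [hG0]
    have hLs : ∀ j, Continuous fun v => L v j := fun j =>
      (continuous_apply j).comp L.continuous
    have hw₀ : L v₀ s ≠ 0 := by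
      rw [hLv₀]
      exact smul_ne_zero hs (hF s).ne_zero
    have hmem : L v₀ s ∈ (φ s (e.symm z)).submodule := by
      rw [hLv₀, (hF s).submodule_eq]
      exact Submodule.smul_mem _ _ (Submodule.mem_span_singleton_self _)
    have key : ∀ q' ∈ (Set.univ : Set C), ∀ᶠ y : V × C in 𝓝 (v₀, q'), y.1 ≠ 0 →
        (∀ j, L y.1 j ∈ (φ j y.2).submodule) → ∃ u ∈ U, ∃ c : ℂ, c ≠ 0 ∧ G u = c • y.1 := by
      intro q' _
      by_cases hq : q' = e.symm z
      · subst hq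
        have hη : ∀ j, ∃ η : E j →L[ℂ] ℂ, η (F j z) ≠ 0 := fun j => by
          obtain ⟨η, -, hη⟩ := exists_dual_vector ℂ (F j z) (norm_ne_zero_iff.mpr (hF j).ne_zero)
          refine ⟨η, ?_⟩
          rw [hη]
          simpa using (hF j).ne_zero
        choose η hη using hη
        have hcη : ∀ j, ContinuousAt (fun y : V × C => η j (F j (e y.2))) (v₀, e.symm z) :=
          fun j => (η j).continuous.continuousAt.comp
            (ContinuousAt.comp (f := Prod.snd) (x := (v₀, e.symm z)) (hF j).continuousAt_comp
              continuousAt_snd)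
        have hcL : ∀ j, ContinuousAt (fun y : V × C => η j (L y.1 j)) (v₀, e.symm z) :=
          fun j => ((η j).continuous.comp ((hLs j).comp continuous_fst)).continuousAt
        have hez : e (e.symm z) = z := e.right_inv (hF s).mem_target
        have hηL : η s (L v₀ s) ≠ 0 := by
          rw [hLv₀, map_smul]
          exact smul_ne_zero hs (hη s)
        -- The inverse coordinates: the base shift in slot `s`, elsewhere the coefficient of `F j`
        -- read off by `η j` after rescaling so that the `s`-th coefficient is `lam s`.
        set κ : V × C → Fin n → ℂ := fun y j => if j = s then e y.2 - z else
          η j (L y.1 j) / η j (F j (e y.2)) * (lam s * η s (F s (e y.2)) / η s (L y.1 s)) - lam j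
          with hκ
        have hκ0 : κ (v₀, e.symm z) = 0 := by
          funext j
          simp only [hκ, hez, hLv₀, map_smul, smul_eq_mul, Pi.zero_apply]
          split_ifs
          · simp
          · have := hη j
            have := hη s
            field_simp
            ring
        have hκc : ContinuousAt κ (v₀, e.symm z) := by
          rw [continuousAt_pi]
          intro j
          by_cases hj : j = s
          · simp only [hκ, hj, if_true]
            refine ContinuousAt.sub ?_ continuousAt_const
            exact ContinuousAt.comp (f := Prod.snd) (x := (v₀, e.symm z))
              (e.continuousAt (e.map_target (hF s).mem_target)) continuousAt_snd
          · simp only [hκ, hj, if_false]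
            refine (((hcL j).div (hcη j) ?_).mul
              ((continuousAt_const.mul (hcη s)).div (hcL s) ?_)).sub continuousAt_const
            · simpa only [hez] using hη j
            · exact hηL
        have hκU : ∀ᶠ y in 𝓝 (v₀, e.symm z), κ y ∈ U := by
          refine hκc.eventually_mem ?_
          rwa [hκ0]
        have h1 : ∀ᶠ y : V × C in 𝓝 (v₀, e.symm z), ∀ j, η j (F j (e y.2)) ≠ 0 :=
          Filter.eventually_all.mpr fun j => (hcη j).eventually_ne (by simpa only [hez] using hη j)
        have h2 := (hcL s).eventually_ne hηL
        have h3 := (continuous_snd.tendsto (v₀, e.symm z)).eventually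
          (Filter.eventually_all.mpr fun j => (hF j).eventually_source)
        filter_upwards [hκU, h1, h2, h3] with y hy1 hy2 hy3 hy4 _ hy
        refine ⟨κ y, hy1, lam s * η s (F s (e y.2)) / η s (L y.1 s),
          div_ne_zero (mul_ne_zero hs (hy2 s)) hy3, ?_⟩
        apply L.injective
        funext j
        rw [hG, apply_scrollParam, map_smul, Pi.smul_apply]
        have hb : z + κ y s = e y.2 := by simp [hκ]
        rw [hb]
        have hyj := hy j
        rw [(hy4 j).2.2] at hyj
        obtain ⟨c, hc⟩ := Submodule.mem_span_singleton.mp hyj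
        have hcj : η j (L y.1 j) = c * η j (F j (e y.2)) := by rw [← hc, map_smul, smul_eq_mul]
        rw [← hc, smul_smul]
        congr 1
        by_cases hj : j = s
        · subst hj
          have h0 := hy2 j
          have hc0 : c ≠ 0 := by
            rintro rfl
            exact hy3 (by rw [hcj, zero_mul])
          rw [if_pos rfl, add_zero, hcj]
          field_simp
        · rw [if_neg hj]
          simp only [hκ, if_neg hj]
          rw [hcj, mul_div_cancel_right₀ _ (hy2 j)]
          ring
      -- Over another base point, the nonzero vector `L v₀ s` is off the line `φ s q'` by
      -- injectivity, so nearby pairs do not satisfy the incidence condition.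
      · obtain ⟨e', F', z', hF', rfl⟩ := hlift s q'
        have hnot : L v₀ s ∉ (φ s (e'.symm z')).submodule := by
          intro hmem'
          apply hq
          apply hinj s
          apply Projectivization.submodule_injective
          rw [submodule_eq_span_singleton hw₀ hmem', submodule_eq_span_singleton hw₀ hmem]
        have h1 := hF'.eventually_notMem_submodule hnot
        have hc : ContinuousAt (fun y : V × C => (L y.1 s, y.2)) (v₀, e'.symm z') :=
          (((hLs s).comp continuous_fst).prodMk continuous_snd).continuousAt
        filter_upwards [hc.eventually h1] with y hy _ hy'
        exact (hy (hy' s)).elim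
    have hall := isCompact_univ.eventually_forall_of_forall_eventually
      (P := fun v q => v ≠ 0 → (∀ j, L v j ∈ (φ j q).submodule) →
        ∃ u ∈ U, ∃ c : ℂ, c ≠ 0 ∧ G u = c • v) key
    filter_upwards [hall] with v hv hv0 hvY
    obtain ⟨q, hq⟩ := (hY v hv0).mp hvY
    obtain ⟨u, huU, c, hc, hu⟩ := hv q (Set.mem_univ q) hv0 hq
    refine ⟨u, huU, ?_, (Projectivization.mk_eq_mk_iff' ℂ _ _ _ _).mpr ⟨c, hu.symm⟩⟩
    rw [hu]
    exact smul_ne_zero hc hv0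

end AbstractScroll

/-! ### The second osculating space of a scroll -/

section OsculatingSpace

open Asymptotics

variable {C : Type*} [TopologicalSpace C] {n : ℕ} {E : Fin n → Type*}
  [∀ j, NormedAddCommGroup (E j)] [∀ j, NormedSpace ℂ (E j)]
  {V : Type*} [NormedAddCommGroup V] [NormedSpace ℂ V]
  {L : V ≃L[ℂ] ∀ j, E j} {φ : ∀ j, C → ℙ ℂ (E j)} {e : OpenPartialHomeomorph C ℂ}
  {F : ∀ j, ℂ → E j} {z : ℂ} {lam : Fin n → ℂ} {s : Fin n}

/-- The span of the tangent directions along all curves through a fibre. -/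
def tangentSum (L : V ≃L[ℂ] ∀ j, E j) (F : ∀ j, ℂ → E j) (z : ℂ) : Submodule ℂ V :=
  (Submodule.pi Set.univ fun j => Submodule.span ℂ {F j z, deriv (F j) z}).comap
    L.toLinearEquiv.toLinearMap

theorem mem_tangentSum {v : V} :
    v ∈ tangentSum L F z ↔ ∀ j, L v j ∈ Submodule.span ℂ {F j z, deriv (F j) z} := by
  simp [tangentSum]

theorem finrank_tangentSum (hF : ∀ j, LinearIndependent ℂ ![F j z, deriv (F j) z]) :
    Module.finrank ℂ (tangentSum L F z) = 2 * n := by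
  have e : tangentSum L F z ≃ₗ[ℂ] ∀ j, Submodule.span ℂ {F j z, deriv (F j) z} :=
    { toFun := fun v j => ⟨L v.1 j, mem_tangentSum.mp v.2 j⟩
      invFun := fun w => ⟨L.symm fun j => w j, mem_tangentSum.mpr fun j => by simp⟩
      map_add' := fun v w => by ext; simp
      map_smul' := fun c v => by ext; simp
      left_inv := fun v => by ext; simp
      right_inv := fun w => by ext; simp }
  have h2 : ∀ j, Module.finrank ℂ (Submodule.span ℂ {F j z, deriv (F j) z}) = 2 := fun j => by
    have := finrank_span_eq_card (hF j)
    rwa [Matrix.range_cons_cons_empty] at this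
  have hfin : ∀ j, Module.Finite ℂ (Submodule.span ℂ {F j z, deriv (F j) z}) := fun j =>
    FiniteDimensional.span_of_finite ℂ (Set.toFinite _)
  rw [e.finrank_eq, Module.finrank_pi_fintype]
  simp [h2, mul_comm]

variable [∀ j, CompleteSpace (E j)] [FiniteDimensional ℂ V]

/-- Expanding each `F j` to order three and applying `ℓ` summand by summand reduces this to the
scalar jets `ℓ (F j)`, `ℓ (F j')`, `ℓ (F j'')`. -/
theorem isBigO_scrollParam_iff (hF : ∀ j, AnalyticAt ℂ (F j) z) (hs : lam s ≠ 0)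
    (ℓ : Module.Dual ℂ V) :
    ((fun u => ℓ (scrollParam L F z lam s u)) =O[𝓝 0] fun u => ‖u‖ ^ 3) ↔
      (∀ j, ℓ (L.symm (Pi.single j (F j z))) = 0) ∧
      (∀ j, ℓ (L.symm (Pi.single j (deriv (F j) z))) = 0) ∧
      ℓ (L.symm fun j => lam j • deriv (deriv (F j)) z) = 0 := by
  have hTaylor : ∀ j, ∃ R : ℂ → E j, ContinuousAt R 0 ∧ ∀ t, F j (z + t) =
      F j z + t • deriv (F j) z + (t ^ 2 / 2) • deriv (deriv (F j)) z + t ^ 3 • R t := by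
    intro j
    have hf : AnalyticAt ℂ (fun t => F j (z + t)) 0 := by
      refine AnalyticAt.comp (g := F j) (f := fun t => z + t) ?_ (analyticAt_const.add analyticAt_id)
      simpa using hF j
    obtain ⟨R, hR, h⟩ := hf.exists_eq_sum_add_pow_mul 3
    refine ⟨R, hR.continuousAt, fun t => ?_⟩
    rw [h t]
    simp [Finset.sum_range_succ, iteratedDeriv_comp_const_add, iteratedDeriv_succ]
  choose R hR hT using hTaylor
  have hsum : ∀ w : ∀ j, E j, ℓ (L.symm w) = ∑ j, ℓ (L.symm (Pi.single j (w j))) := by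
    intro w
    conv_lhs => rw [← Finset.univ_sum_single w]
    rw [map_sum, map_sum]
  set Λ : ∀ j, E j →ₗ[ℂ] ℂ := fun j =>
    ℓ ∘ₗ L.symm.toLinearEquiv.toLinearMap ∘ₗ LinearMap.single ℂ E j with hΛ
  have hΛa : ∀ j v, ℓ (L.symm (Pi.single j v)) = Λ j v := fun j v => rfl
  have hΛc : ∀ j, ContinuousAt (fun t => Λ j (R j t)) 0 := by
    intro j
    have h1 : Continuous (Λ j) := by
      have : Continuous ℓ := LinearMap.continuous_of_finiteDimensional ℓ
      exact this.comp (L.symm.continuous.comp (continuous_single j))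
    exact h1.continuousAt.comp (hR j)
  rw [hsum]
  simp only [hΛa, map_smul, smul_eq_mul]
  rw [← isBigO_norm_pow_three_iff_jet_eq_zero hΛc hs]
  refine isBigO_congr (Filter.Eventually.of_forall fun u => ?_) Filter.EventuallyEq.rfl
  simp only [scrollParam]
  rw [hsum]
  simp only [hΛa, hT, map_smul, smul_eq_mul, map_add]

variable [CompactSpace C]

/-- Both sides have the same annihilator, computed along `scrollParam`. Second derivatives enter
only through one combination because all the curves share the base parameter. -/
theorem oscSpace_eq (hF : ∀ j, IsLocalLift e (φ j) (F j) z)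
    (hinj : ∀ j, Function.Injective (φ j))
    (hlift : ∀ j q, ∃ (e' : OpenPartialHomeomorph C ℂ) (F' : ℂ → E j) (z' : ℂ),
      IsLocalLift e' (φ j) F' z' ∧ e'.symm z' = q)
    {Y : Set (ℙ ℂ V)}
    (hY : ∀ v (hv : v ≠ 0), Projectivization.mk ℂ v hv ∈ Y ↔
      ∃ q, ∀ j, L v j ∈ (φ j q).submodule)
    {v₀ : V} (hv₀ : v₀ ≠ 0) (hLv₀ : ∀ j, L v₀ j = lam j • F j z) :
    oscSpace n 2 Y (Projectivization.mk ℂ v₀ hv₀) =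
      tangentSum L F z ⊔ Submodule.span ℂ {L.symm fun j => lam j • deriv (deriv (F j)) z} := by
  obtain ⟨s, hs⟩ : ∃ s, lam s ≠ 0 := by
    by_contra! h
    apply hv₀
    apply L.injective
    funext j
    simp [hLv₀, h]
  rw [← Subspace.dualAnnihilator_inj]
  ext ℓ
  have hpar := isLocalParametrization_scrollParam hF hinj hlift hY hs hv₀ hLv₀
  rw [hpar.mem_dualAnnihilator_oscSpace_iff,
    isBigO_scrollParam_iff (fun j => (hF j).analyticAt) hs, Submodule.dualAnnihilator_sup_eq,
    Submodule.mem_inf, Submodule.mem_dualAnnihilator, ← and_assoc]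
  refine and_congr ⟨fun ⟨h1, h2⟩ v hv => ?_, fun h => ⟨fun j => h _ ?_, fun j => h _ ?_⟩⟩ ?_
  · rw [mem_tangentSum] at hv
    have hv' : v = ∑ j, L.symm (Pi.single j (L v j)) := by
      rw [← map_sum, Finset.univ_sum_single, L.symm_apply_apply]
    rw [hv', map_sum]
    refine Finset.sum_eq_zero fun j _ => ?_
    obtain ⟨a, b, hab⟩ := Submodule.mem_span_pair.mp (hv j)
    rw [← hab, Pi.single_add, Pi.single_smul, Pi.single_smul, map_add, map_smul, map_smul, map_add,
      map_smul, map_smul, h1, h2]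
    simp
  · refine mem_tangentSum.mpr fun i => ?_
    rw [L.apply_symm_apply]
    by_cases hi : i = j
    · subst hi
      simpa using Submodule.subset_span (by simp)
    · simp [hi]
  · refine mem_tangentSum.mpr fun i => ?_
    rw [L.apply_symm_apply]
    by_cases hi : i = j
    · subst hi
      simpa using Submodule.subset_span (by simp)
    · simp [hi]
  · rw [Submodule.mem_dualAnnihilator]
    refine ⟨fun h w hw => ?_, fun h => h _ (Submodule.mem_span_singleton_self _)⟩
    obtain ⟨a, rfl⟩ := Submodule.mem_span_singleton.mp hw
    rw [map_smul, h, smul_zero]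

/-- The second osculating space of a decomposable scroll at `∑ j, lam j F j z` has the expected
dimension unless all the curves with `lam j ≠ 0` are inflected. -/
theorem finrank_oscSpace (hF : ∀ j, IsLocalLift e (φ j) (F j) z)
    (hinj : ∀ j, Function.Injective (φ j))
    (hlift : ∀ j q, ∃ (e' : OpenPartialHomeomorph C ℂ) (F' : ℂ → E j) (z' : ℂ),
      IsLocalLift e' (φ j) F' z' ∧ e'.symm z' = q)
    {Y : Set (ℙ ℂ V)}
    (hY : ∀ v (hv : v ≠ 0), Projectivization.mk ℂ v hv ∈ Y ↔
      ∃ q, ∀ j, L v j ∈ (φ j q).submodule)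
    {v₀ : V} (hv₀ : v₀ ≠ 0) (hLv₀ : ∀ j, L v₀ j = lam j • F j z) :
    ((∀ j, lam j • deriv (deriv (F j)) z ∈ Submodule.span ℂ {F j z, deriv (F j) z}) →
      Module.finrank ℂ (oscSpace n 2 Y (Projectivization.mk ℂ v₀ hv₀)) = 2 * n) ∧
    ((¬ ∀ j, lam j • deriv (deriv (F j)) z ∈ Submodule.span ℂ {F j z, deriv (F j) z}) →
      Module.finrank ℂ (oscSpace n 2 Y (Projectivization.mk ℂ v₀ hv₀)) = 2 * n + 1) := by
  have hmem : (L.symm fun j => lam j • deriv (deriv (F j)) z) ∈ tangentSum L F z ↔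
      ∀ j, lam j • deriv (deriv (F j)) z ∈ Submodule.span ℂ {F j z, deriv (F j) z} := by
    simp [mem_tangentSum]
  have hrank := finrank_tangentSum (L := L) fun j => (hF j).linearIndependent
  rw [oscSpace_eq hF hinj hlift hY hv₀ hLv₀, ← hmem]
  constructor
  · intro h
    rw [sup_eq_left.mpr ((Submodule.span_singleton_le_iff_mem _ _).mpr h), hrank]
  · intro h
    rw [Submodule.finrank_sup_span_singleton h, hrank]

end OsculatingSpace

/-! ### Curves and their non-flexes -/

section Curves

variable {C : Type*} [TopologicalSpace C] {V : Type*} [NormedAddCommGroup V] [NormedSpace ℂ V]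
  [FiniteDimensional ℂ V]

/-- If `F''` stays in the span of `F` and `F'`, then `F` stays in the span of its first two
derivatives at the base point. -/
theorem eventually_mem_span_pair_of_deriv_deriv_mem {F : ℂ → V} {z : ℂ} (hF : AnalyticAt ℂ F z)
    (hli : LinearIndependent ℂ ![F z, deriv F z])
    (h : ∀ᶠ w in 𝓝 z, deriv (deriv F) w ∈ Submodule.span ℂ {F w, deriv F w}) :
    ∀ᶠ w in 𝓝 z, F w ∈ Submodule.span ℂ {F z, deriv F z} ∧
      deriv F w ∈ Submodule.span ℂ {F z, deriv F z} := by
  have : CompleteSpace V := FiniteDimensional.complete ℂ V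
  set f : (Fin 2 → ℂ) →ₗ[ℂ] V := Fintype.linearCombination ℂ ![F z, deriv F z] with hf
  have hfker : LinearMap.ker f = ⊥ := LinearMap.ker_eq_bot.mpr
    (hli.fintypeLinearCombination_injective)
  obtain ⟨g, hg⟩ := f.exists_leftInverse_of_injective hfker
  have hgf : ∀ c, g (f c) = c := fun c => LinearMap.congr_fun hg c
  have hf0 : f ![1, 0] = F z := by simp [hf, Fintype.linearCombination_apply]
  have hf1 : f ![0, 1] = deriv F z := by simp [hf, Fintype.linearCombination_apply]
  have hfmem : ∀ c, f c ∈ Submodule.span ℂ {F z, deriv F z} := fun c =>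
    Submodule.mem_span_pair.mpr ⟨c 0, c 1, by simp [hf, Fintype.linearCombination_apply]⟩
  -- A projection with kernel `⟨F z, F' z⟩`; the goal is that it kills `F` and `F'` near `z`.
  set π : V →L[ℂ] V := LinearMap.toContinuousLinearMap (LinearMap.id - f ∘ₗ g) with hπ
  have hπv : ∀ v, π v = v - f (g v) := fun v => rfl
  have hmem : ∀ v, π v = 0 → v ∈ Submodule.span ℂ {F z, deriv F z} := by
    intro v hv
    rw [hπv, sub_eq_zero] at hv
    rw [hv]
    exact hfmem _
  set η : Fin 2 → V →L[ℂ] ℂ := fun i =>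
    LinearMap.toContinuousLinearMap (LinearMap.proj i ∘ₗ g) with hη
  have hηv : ∀ i v, η i v = g v i := fun i v => rfl
  have hFd := hF.deriv
  have hFdd := hFd.deriv
  have hηa : ∀ i {G : ℂ → V}, AnalyticAt ℂ G z → AnalyticAt ℂ (fun w => η i (G w)) z :=
    fun i G hG => ((η i).analyticAt _).comp hG
  set M : ℂ → ℂ := fun w => η 0 (F w) * η 1 (deriv F w) - η 1 (F w) * η 0 (deriv F w) with hM
  have hMa : AnalyticAt ℂ M z :=
    ((hηa 0 hF).mul (hηa 1 hFd)).sub ((hηa 1 hF).mul (hηa 0 hFd))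
  have hMz : M z ≠ 0 := by
    simp only [hM, hηv]
    rw [← hf0, ← hf1, hgf, hgf]
    simp
  -- Cramer's rule, with the Wronskian-type determinant `M` nonzero at `z`, gives analytic
  -- coefficients in `F'' = a F + b F'`.
  set a : ℂ → ℂ := fun w => (η 0 (deriv (deriv F) w) * η 1 (deriv F w) -
    η 1 (deriv (deriv F) w) * η 0 (deriv F w)) / M w with ha
  set b : ℂ → ℂ := fun w => (η 0 (F w) * η 1 (deriv (deriv F) w) -
    η 1 (F w) * η 0 (deriv (deriv F) w)) / M w with hb
  have haa : AnalyticAt ℂ a z :=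
    (((hηa 0 hFdd).mul (hηa 1 hFd)).sub ((hηa 1 hFdd).mul (hηa 0 hFd))).div hMa hMz
  have hba : AnalyticAt ℂ b z :=
    (((hηa 0 hF).mul (hηa 1 hFdd)).sub ((hηa 1 hF).mul (hηa 0 hFdd))).div hMa hMz
  have hode : ∀ᶠ w in 𝓝 z, deriv (deriv F) w = a w • F w + b w • deriv F w := by
    filter_upwards [h, hMa.continuousAt.eventually_ne hMz] with w hw hMw
    obtain ⟨α, β, hαβ⟩ := Submodule.mem_span_pair.mp hw
    have e : ∀ i, η i (deriv (deriv F) w) = α * η i (F w) + β * η i (deriv F w) := fun i => by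
      rw [← hαβ, map_add, map_smul, map_smul, smul_eq_mul, smul_eq_mul]
    have h1 : a w = α := by
      simp only [ha, e]
      rw [div_eq_iff hMw]
      simp only [hM]
      ring
    have h2 : b w = β := by
      simp only [hb, e]
      rw [div_eq_iff hMw]
      simp only [hM]
      ring
    rw [h1, h2, hαβ]
  set k : ℂ → V := fun w => π (F w) with hk
  have hka : AnalyticAt ℂ k z := (π.analyticAt _).comp hF
  have hπd : ∀ {G : ℂ → V} {w : ℂ}, AnalyticAt ℂ G w →
      deriv (fun w => π (G w)) w = π (deriv G w) := fun hG =>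
    (π.hasFDerivAt.comp_hasDerivAt _ hG.differentiableAt.hasDerivAt).deriv
  have hk1 : ∀ᶠ w in 𝓝 z, deriv k w = π (deriv F w) := by
    filter_upwards [hF.eventually_analyticAt] with w hw
    exact hπd hw
  have hk2 : ∀ᶠ w in 𝓝 z, deriv (deriv k) w = π (deriv (deriv F) w) := by
    filter_upwards [hk1.eventually_nhds, hFd.eventually_analyticAt] with w hw hw'
    rw [Filter.EventuallyEq.deriv_eq (hw : deriv k =ᶠ[𝓝 w] fun w => π (deriv F w)), hπd hw']
  have hkode : deriv (deriv k) =ᶠ[𝓝 z] a • k + b • deriv k := by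
    filter_upwards [hode, hk1, hk2] with w h1 h2 h3
    rw [h3, h1, map_add, map_smul, map_smul, Pi.add_apply, Pi.smul_apply', Pi.smul_apply', h2]
  have hkz : k z = 0 := by
    simp only [hk, hπv]
    rw [← hf0, hgf, sub_self]
  have hk1z : deriv k z = 0 := by
    rw [hk1.self_of_nhds, hπv, ← hf1, hgf, sub_self]
  have ho1 : analyticOrderAt (deriv k) z + 1 = analyticOrderAt k z := by
    simpa [hkz] using hka.analyticOrderAt_deriv_add_one
  have ho2 : analyticOrderAt (deriv (deriv k)) z + 1 = analyticOrderAt (deriv k) z := by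
    simpa [hk1z] using hka.deriv.analyticOrderAt_deriv_add_one
  -- Uniqueness for `k'' = a k + b k'` with zero initial data, by orders: the equation gives `ord k'
  -- ≤ ord k''`, while `ord k' = ord k'' + 1`, so all orders are infinite.
  have ho3 : analyticOrderAt (deriv k) z ≤ analyticOrderAt (deriv (deriv k)) z := by
    rw [analyticOrderAt_congr hkode]
    refine le_trans (le_min ?_ ?_) le_analyticOrderAt_add
    · rw [analyticOrderAt_smul haa hka, ← ho1]
      exact le_self_add.trans le_add_self
    · rw [analyticOrderAt_smul hba hka.deriv]
      exact le_add_self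
  have htop : analyticOrderAt (deriv (deriv k)) z = ⊤ := by
    rw [← ho2] at ho3
    by_contra hne
    exact absurd ho3 (not_le.mpr (ENat.lt_add_one_iff hne |>.mpr le_rfl))
  have htop1 : analyticOrderAt (deriv k) z = ⊤ := by rw [← ho2, htop]; rfl
  have htop0 : analyticOrderAt k z = ⊤ := by rw [← ho1, htop1]; rfl
  rw [analyticOrderAt_eq_top] at htop0 htop1
  filter_upwards [htop0, htop1, hk1] with w h1 h2 h3
  exact ⟨hmem _ h1, hmem _ (h3 ▸ h2)⟩

variable {φ : C → ℙ ℂ V} {e : OpenPartialHomeomorph C ℂ} {F : ℂ → V} {z : ℂ}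

variable [CompactSpace C]

theorem oscSpace_curve_eq (hF : IsLocalLift e φ F z) (hinj : Function.Injective φ)
    (hlift : ∀ q, ∃ (e' : OpenPartialHomeomorph C ℂ) (F' : ℂ → V) (z' : ℂ),
      IsLocalLift e' φ F' z' ∧ e'.symm z' = q) :
    oscSpace 1 2 (Set.range φ) (φ (e.symm z)) =
      Submodule.span ℂ {F z, deriv F z} ⊔ Submodule.span ℂ {deriv (deriv F) z} := by
  have : CompleteSpace V := FiniteDimensional.complete ℂ V
  obtain ⟨h0, h1⟩ := hF.eventually_mk.self_of_nhds
  -- A curve is the scroll with one summand and coefficient `1`.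
  have h2 := oscSpace_eq (n := 1) (E := fun _ => V) (φ := fun _ => φ) (F := fun _ => F)
    (L := (ContinuousLinearEquiv.funUnique (Fin 1) ℂ V).symm) (lam := fun _ => 1)
    (fun _ => hF) (fun _ => hinj) (fun _ => hlift) (Y := Set.range φ)
    (fun v hv => by simpa using mk_mem_range_iff hv) h0 (fun j => by simp)
  rw [← h1, h2]
  congr 1
  · ext v
    simp [mem_tangentSum]
  · simp

theorem finrank_oscSpace_curve (hF : IsLocalLift e φ F z) (hinj : Function.Injective φ)
    (hlift : ∀ q, ∃ (e' : OpenPartialHomeomorph C ℂ) (F' : ℂ → V) (z' : ℂ),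
      IsLocalLift e' φ F' z' ∧ e'.symm z' = q) :
    (deriv (deriv F) z ∈ Submodule.span ℂ {F z, deriv F z} →
      Module.finrank ℂ (oscSpace 1 2 (Set.range φ) (φ (e.symm z))) = 2) ∧
    (deriv (deriv F) z ∉ Submodule.span ℂ {F z, deriv F z} →
      Module.finrank ℂ (oscSpace 1 2 (Set.range φ) (φ (e.symm z))) = 3) := by
  have h2 : Module.finrank ℂ (Submodule.span ℂ {F z, deriv F z}) = 2 := by
    have := finrank_span_eq_card hF.linearIndependent
    rwa [Matrix.range_cons_cons_empty] at this
  rw [oscSpace_curve_eq hF hinj hlift]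
  constructor
  · intro h
    rw [sup_eq_left.mpr ((Submodule.span_singleton_le_iff_mem _ _).mpr h), h2]
  · intro h
    rw [Submodule.finrank_sup_span_singleton h, h2]

/-- A non-degenerate curve that is not a line has a point that is not inflected. -/
theorem exists_finrank_oscSpace_eq_three [ConnectedSpace C] (hinj : Function.Injective φ)
    (hlift : ∀ q, ∃ (e' : OpenPartialHomeomorph C ℂ) (F' : ℂ → V) (z' : ℂ),
      IsLocalLift e' φ F' z' ∧ e'.symm z' = q)
    (hnd : ⨆ q, (φ q).submodule = ⊤) (hV : 3 ≤ Module.finrank ℂ V) :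
    ∃ q, Module.finrank ℂ (oscSpace 1 2 (Set.range φ) (φ q)) = 3 := by
  by_contra! hcon
  have hinfl : ∀ {e : OpenPartialHomeomorph C ℂ} {F : ℂ → V} {z : ℂ}, IsLocalLift e φ F z →
      deriv (deriv F) z ∈ Submodule.span ℂ {F z, deriv F z} ∧
      oscSpace 1 2 (Set.range φ) (φ (e.symm z)) = Submodule.span ℂ {F z, deriv F z} := by
    intro e F z hF
    have h1 : deriv (deriv F) z ∈ Submodule.span ℂ {F z, deriv F z} := by
      by_contra h
      exact hcon _ ((finrank_oscSpace_curve hF hinj hlift).2 h)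
    refine ⟨h1, ?_⟩
    rw [oscSpace_curve_eq hF hinj hlift,
      sup_eq_left.mpr ((Submodule.span_singleton_le_iff_mem _ _).mpr h1)]
  have : CompleteSpace V := FiniteDimensional.complete ℂ V
  -- If every point is inflected, the tangent line is locally constant, hence constant; it contains
  -- the whole curve, against non-degeneracy in dimension at least three.
  have hloc : IsLocallyConstant fun q => oscSpace 1 2 (Set.range φ) (φ q) := by
    rw [IsLocallyConstant.iff_eventually_eq]
    intro q
    obtain ⟨e, F, z, hF, rfl⟩ := hlift q
    have hev := eventually_mem_span_pair_of_deriv_deriv_mem hF.analyticAt hF.linearIndependent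
      (hF.eventually.mono fun w hw => (hinfl hw).1)
    have hs : e.symm z ∈ e.source := e.map_target hF.mem_target
    have hc := (e.continuousAt hs).tendsto
    rw [e.right_inv hF.mem_target] at hc
    filter_upwards [e.open_source.mem_nhds hs, hc.eventually (hev.and hF.eventually)]
      with q hq ⟨⟨h1, h2⟩, h3⟩
    rw [← e.left_inv hq, (hinfl h3).2, (hinfl hF).2]
    refine Submodule.eq_of_le_of_finrank_eq ?_ ?_
    · rw [Submodule.span_le]
      rintro x (rfl | rfl)
      exacts [h1, h2]
    · have e1 := finrank_span_eq_card h3.linearIndependent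
      have e2 := finrank_span_eq_card hF.linearIndependent
      rw [Matrix.range_cons_cons_empty] at e1 e2
      rw [e1, e2]
  obtain ⟨q₀⟩ := (inferInstance : Nonempty C)
  have hle : ∀ q, (φ q).submodule ≤ oscSpace 1 2 (Set.range φ) (φ q₀) := by
    intro q
    have h1 : oscSpace 1 2 (Set.range φ) (φ q₀) = oscSpace 1 2 (Set.range φ) (φ q) :=
      hloc.apply_eq_of_preconnectedSpace _ _
    rw [h1]
    obtain ⟨e, F, z, hF, rfl⟩ := hlift q
    rw [(hinfl hF).2, hF.submodule_eq]
    exact Submodule.span_mono (by simp)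
  have htop : oscSpace 1 2 (Set.range φ) (φ q₀) = ⊤ := by
    rw [eq_top_iff, ← hnd]
    exact iSup_le hle
  obtain ⟨e, F, z, hF, rfl⟩ := hlift q₀
  have h2 := (finrank_oscSpace_curve hF hinj hlift).1 (hinfl hF).1
  rw [htop, finrank_top] at h2
  omega

end Curves

/-! ### The decomposable scroll in coordinates and its inflection criterion -/

section Scroll

variable {C : Type*} {n : ℕ} {r : Fin n → ℕ} {φ : ∀ i : Fin n, C → ℙ ℂ (Fin (r i + 1) → ℂ)}
  {p : C} {v : ∀ j : Fin n, Fin (r j + 1) → ℂ}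

theorem mk_mem_span_vertex_iff (hv : v ≠ 0) (I : Set (Fin n)) :
    Projectivization.mk ℂ v hv ∈ Projectivization.Subspace.span (vertex φ p '' I) ↔
      ∀ j, v j ∈ (φ j p).submodule ∧ (j ∉ I → v j = 0) := by
  classical
  constructor
  · intro h
    set W : Submodule ℂ (∀ j : Fin n, Fin (r j + 1) → ℂ) :=
      Submodule.pi Set.univ fun j => if j ∈ I then (φ j p).submodule else ⊥ with hW
    have hle : Projectivization.Subspace.span (vertex φ p '' I) ≤ W.projectivization := by
      rw [Projectivization.Subspace.span_le_subspace_iff]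
      rintro _ ⟨i, hi, rfl⟩
      obtain ⟨w, hw, hwi⟩ : ∃ w, ∃ hw : w ≠ 0, Projectivization.mk ℂ w hw = φ i p :=
        ⟨_, (φ i p).rep_nonzero, (φ i p).mk_rep⟩
      simp only [vertex, ← hwi]
      refine (Submodule.mk_mem_projectivization_iff _ _).mpr ?_
      rw [hW, Submodule.mem_pi]
      intro j _
      by_cases hj : j = i
      · subst hj
        simp [hi, ← hwi, Projectivization.submodule_mk, Submodule.mem_span_singleton_self]
      · simp [hj]
    have h1 := (Submodule.mk_mem_projectivization_iff _ _).mp (hle h)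
    intro j
    have h2 := Submodule.mem_pi.mp h1 j (Set.mem_univ j)
    by_cases hj : j ∈ I
    · rw [if_pos hj] at h2
      exact ⟨h2, fun h => (h hj).elim⟩
    · rw [if_neg hj, Submodule.mem_bot] at h2
      rw [h2]
      exact ⟨Submodule.zero_mem _, fun _ => rfl⟩
  · intro h
    rw [← Projectivization.Subspace.mem_submodule_iff, ← Finset.univ_sum_single v]
    refine Submodule.sum_mem _ fun j _ => ?_
    by_cases hj : v j = 0
    · rw [hj, Pi.single_zero]
      exact Submodule.zero_mem _
    · have hne : (Pi.single j (v j) : ∀ j : Fin n, Fin (r j + 1) → ℂ) ≠ 0 := by simpa using hj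
      rw [Projectivization.Subspace.mem_submodule_iff _ hne]
      refine Projectivization.Subspace.subset_span _ ⟨j, ?_, ?_⟩
      · by_contra hI
        exact hj ((h j).2 hI)
      · have hφ : φ j p = Projectivization.mk ℂ (v j) hj := by
          apply Projectivization.submodule_injective
          rw [submodule_eq_span_singleton hj (h j).1, Projectivization.submodule_mk]
        simp only [vertex, hφ]
        rfl

theorem mk_mem_fibre_iff (hv : v ≠ 0) :
    Projectivization.mk ℂ v hv ∈ fibre φ p ↔ ∀ j, v j ∈ (φ j p).submodule := by
  rw [fibre, ← Set.image_univ, SetLike.mem_coe, mk_mem_span_vertex_iff]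
  simp

theorem mk_mem_face_iff (hv : v ≠ 0) (h : ∀ j, v j ∈ (φ j p).submodule) (s : Fin n) :
    Projectivization.mk ℂ v hv ∈ face φ p s ↔ v s = 0 := by
  rw [face, SetLike.mem_coe, mk_mem_span_vertex_iff]
  simp [h]

theorem mk_mem_scroll_iff (hv : v ≠ 0) :
    Projectivization.mk ℂ v hv ∈ scroll φ ↔ ∃ q, ∀ j, v j ∈ (φ j q).submodule := by
  simp [scroll, mk_mem_fibre_iff]

theorem exists_vertex_eq_mk (p : C) (i : Fin n) : ∃ w, w ≠ 0 ∧ w ∈ (φ i p).submodule ∧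
    ∃ h : (Pi.single i w : ∀ j : Fin n, Fin (r j + 1) → ℂ) ≠ 0,
      vertex φ p i = Projectivization.mk ℂ (Pi.single i w) h := by
  obtain ⟨w, hw, hwi⟩ : ∃ w, ∃ hw : w ≠ 0, Projectivization.mk ℂ w hw = φ i p :=
    ⟨_, (φ i p).rep_nonzero, (φ i p).mk_rep⟩
  refine ⟨w, hw, ?_, by simpa using hw, ?_⟩
  · rw [← hwi, Projectivization.submodule_mk]
    exact Submodule.mem_span_singleton_self w
  · simp only [vertex, ← hwi]
    rfl

theorem single_mem_submodule {i : Fin n} {w : Fin (r i + 1) → ℂ} (hw : w ∈ (φ i p).submodule)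
    (j : Fin n) : (Pi.single i w : ∀ j : Fin n, Fin (r j + 1) → ℂ) j ∈ (φ j p).submodule := by
  by_cases hj : j = i
  · subst hj
    simpa using hw
  · simp [hj]

variable [TopologicalSpace C] [ChartedSpace ℂ C]

theorem IsNondegenerateEmbedding.exists_isLocalLift {V : Type*} [NormedAddCommGroup V]
    [NormedSpace ℂ V] {ψ : C → ℙ ℂ V} (hψ : IsNondegenerateEmbedding ψ) (q : C) :
    ∃ F, IsLocalLift (chartAt ℂ q) ψ F (chartAt ℂ q q) := by
  obtain ⟨F, h1, h2, h3⟩ := hψ.holomorphic_immersion q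
  exact ⟨F, mem_chart_target ℂ q, h1, h2, h3⟩

theorem chartAt_symm_apply_self (q : C) : (chartAt ℂ q).symm (chartAt ℂ q q) = q :=
  (chartAt ℂ q).left_inv (mem_chart_source ℂ q)

theorem IsNondegenerateEmbedding.exists_isLocalLift_symm_eq {V : Type*} [NormedAddCommGroup V]
    [NormedSpace ℂ V] {ψ : C → ℙ ℂ V} (hψ : IsNondegenerateEmbedding ψ) (q : C) :
    ∃ (e' : OpenPartialHomeomorph C ℂ) (F' : ℂ → V) (z' : ℂ),
      IsLocalLift e' ψ F' z' ∧ e'.symm z' = q := by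
  obtain ⟨F, hF⟩ := hψ.exists_isLocalLift q
  exact ⟨_, F, _, hF, chartAt_symm_apply_self q⟩

theorem IsNondegenerateEmbedding.one_le (hφ : ∀ i, IsNondegenerateEmbedding (φ i)) (p : C)
    (i : Fin n) : 1 ≤ r i := by
  obtain ⟨F, hF⟩ := (hφ i).exists_isLocalLift p
  have := hF.linearIndependent.fintype_card_le_finrank
  simp at this
  exact this

variable [CompactSpace C] [ConnectedSpace C]

/-- The convention for lines agrees with the derivative condition, which is automatic in a
two-dimensional space. Otherwise a non-inflected point exists, so the generic rank is `3`. -/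
theorem isFlex_iff (hφ : ∀ i, IsNondegenerateEmbedding (φ i)) {i : Fin n}
    {F : ℂ → Fin (r i + 1) → ℂ} (hF : IsLocalLift (chartAt ℂ p) (φ i) F (chartAt ℂ p p)) :
    IsFlex φ p i ↔ deriv (deriv F) (chartAt ℂ p p) ∈
      Submodule.span ℂ {F (chartAt ℂ p p), deriv F (chartAt ℂ p p)} := by
  have hrank := finrank_oscSpace_curve hF (hφ i).injective (hφ i).exists_isLocalLift_symm_eq
  rw [chartAt_symm_apply_self] at hrank
  simp only [IsFlex, inflectionalLocus, Set.mem_ofPred_eq, Set.mem_range_self, true_and,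
    Module.finrank_fin_fun, Set.exists_range_iff]
  constructor
  · intro h
    by_contra hn
    have h3 := hrank.2 hn
    rcases h with h | ⟨q, hq⟩
    · have := Submodule.finrank_le (oscSpace 1 2 (Set.range (φ i)) (φ i p))
      rw [h3, Module.finrank_fin_fun] at this
      omega
    · obtain ⟨F', hF'⟩ := (hφ i).exists_isLocalLift q
      have hrank' := finrank_oscSpace_curve hF' (hφ i).injective
        (hφ i).exists_isLocalLift_symm_eq
      rw [chartAt_symm_apply_self] at hrank'
      by_cases hq' : deriv (deriv F') (chartAt ℂ q q) ∈
        Submodule.span ℂ {F' (chartAt ℂ q q), deriv F' (chartAt ℂ q q)}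
      · have := hrank'.1 hq'
        omega
      · have := hrank'.2 hq'
        omega
  · intro h
    by_cases hr : r i + 1 < 2 * 1 + 1
    · exact Or.inl hr
    · obtain ⟨q, hq⟩ := exists_finrank_oscSpace_eq_three (hφ i).injective
        (hφ i).exists_isLocalLift_symm_eq (hφ i).nondegenerate (by
          rw [Module.finrank_fin_fun]
          omega)
      refine Or.inr ⟨q, ?_⟩
      rw [hrank.1 h, hq]
      omega

/-- Unless `C_i` is a line, some point of it is not a flex. -/
theorem exists_not_isFlex (hφ : ∀ i, IsNondegenerateEmbedding (φ i)) {i : Fin n} (hi : 2 ≤ r i) :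
    ∃ q, ¬ IsFlex φ q i := by
  obtain ⟨q, hq⟩ := exists_finrank_oscSpace_eq_three (hφ i).injective
    (hφ i).exists_isLocalLift_symm_eq (hφ i).nondegenerate (by
      rw [Module.finrank_fin_fun]
      omega)
  refine ⟨q, fun h => ?_⟩
  obtain ⟨F, hF⟩ := (hφ i).exists_isLocalLift q
  have hrank := finrank_oscSpace_curve hF (hφ i).injective (hφ i).exists_isLocalLift_symm_eq
  rw [chartAt_symm_apply_self] at hrank
  have := hrank.1 ((isFlex_iff hφ hF).mp h)
  omega

theorem finrank_oscSpace_scroll (hφ : ∀ i, IsNondegenerateEmbedding (φ i)) (hv : v ≠ 0)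
    (hvp : ∀ j, v j ∈ (φ j p).submodule) :
    ((∀ j, v j ≠ 0 → IsFlex φ p j) →
      Module.finrank ℂ (oscSpace n 2 (scroll φ) (Projectivization.mk ℂ v hv)) = 2 * n) ∧
    ((¬ ∀ j, v j ≠ 0 → IsFlex φ p j) →
      Module.finrank ℂ (oscSpace n 2 (scroll φ) (Projectivization.mk ℂ v hv)) = 2 * n + 1) := by
  have hF : ∀ j, ∃ F, IsLocalLift (chartAt ℂ p) (φ j) F (chartAt ℂ p p) := fun j =>
    (hφ j).exists_isLocalLift p
  choose F hF using hF
  have hlam : ∀ j, ∃ a : ℂ, a • F j (chartAt ℂ p p) = v j := by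
    intro j
    have h := hvp j
    have h1 := (hF j).submodule_eq
    rw [chartAt_symm_apply_self] at h1
    rwa [h1, Submodule.mem_span_singleton] at h
  choose lam hlam using hlam
  have hiff : (∀ j, v j ≠ 0 → IsFlex φ p j) ↔
      ∀ j, lam j • deriv (deriv (F j)) (chartAt ℂ p p) ∈
        Submodule.span ℂ {F j (chartAt ℂ p p), deriv (F j) (chartAt ℂ p p)} := by
    refine forall_congr' fun j => ?_
    rw [isFlex_iff hφ (hF j), ← hlam j]
    by_cases h0 : lam j = 0
    · simp [h0]
    · rw [Submodule.smul_mem_iff _ h0]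
      simp [h0, (hF j).ne_zero]
  rw [hiff]
  exact finrank_oscSpace (L := ContinuousLinearEquiv.refl ℂ _) hF (fun j => (hφ j).injective)
    (fun j => (hφ j).exists_isLocalLift_symm_eq) (fun v hv => mk_mem_scroll_iff hv) hv
    (fun j => (hlam j).symm)

/-- A point of the fibre over `p` is inflected if and only if `p` gives a flex of every curve that
contributes to it. -/
theorem mk_mem_inflectionalLocus_scroll_iff (hφ : ∀ i, IsNondegenerateEmbedding (φ i)) (hv : v ≠ 0)
    (hvp : ∀ j, v j ∈ (φ j p).submodule) :
    Projectivization.mk ℂ v hv ∈ inflectionalLocus n (scroll φ) ↔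
      ∀ j, v j ≠ 0 → IsFlex φ p j := by
  have hdim : Module.finrank ℂ (∀ j : Fin n, Fin (r j + 1) → ℂ) = ∑ j, (r j + 1) := by
    rw [Module.finrank_pi_fintype]
    simp
  have hmem : Projectivization.mk ℂ v hv ∈ scroll φ := (mk_mem_scroll_iff hv).mpr ⟨p, hvp⟩
  simp only [inflectionalLocus, Set.mem_ofPred_eq, hmem, true_and]
  have hrank := finrank_oscSpace_scroll hφ hv hvp
  constructor
  · intro h
    by_contra hn
    have h1 := hrank.2 hn
    rcases h with h | ⟨y, hy, hlt⟩
    · have := Submodule.finrank_le (oscSpace n 2 (scroll φ) (Projectivization.mk ℂ v hv))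
      omega
    · induction y using Projectivization.ind with
      | h w hw =>
        obtain ⟨q, hq⟩ := (mk_mem_scroll_iff hw).mp hy
        have hrank' := finrank_oscSpace_scroll hφ hw hq
        by_cases hw' : ∀ j, w j ≠ 0 → IsFlex φ q j
        · have := hrank'.1 hw'
          omega
        · have := hrank'.2 hw'
          omega
  · intro h
    have h1 := hrank.1 h
    -- If all curves are lines, the ambient dimension `2 * n` triggers the convention; otherwise the
    -- vertex over a non-flex of some `C_i` attains rank `2 * n + 1`.
    by_cases hr : ∀ j, r j = 1
    · left
      rw [hdim]
      simp [hr, mul_comm]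
    · right
      push Not at hr
      obtain ⟨i, hi⟩ := hr
      have h2 : 2 ≤ r i := by
        have := IsNondegenerateEmbedding.one_le hφ p i
        omega
      obtain ⟨q, hq⟩ := exists_not_isFlex hφ h2
      obtain ⟨w, hw0, hw, hw', hwv⟩ := exists_vertex_eq_mk (φ := φ) q i
      refine ⟨_, (mk_mem_scroll_iff hw').mpr ⟨q, single_mem_submodule hw⟩, ?_⟩
      rw [h1, (finrank_oscSpace_scroll hφ hw' (single_mem_submodule hw)).2 fun hall =>
        hq (hall i (by simpa using hw0))]
      omega

end Scroll

end DecomposableScroll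

end

/-! ### The theorem -/

open DecomposableScroll in
theorem theorem1p2
    {C : Type*} [TopologicalSpace C] [T2Space C] [CompactSpace C] [ConnectedSpace C]
    [ChartedSpace ℂ C] [IsManifold 𝓘(ℂ) ω C]
    {n : ℕ} (hn : 1 ≤ n) {r : Fin n → ℕ}
    (φ : ∀ i : Fin n, C → ℙ ℂ (Fin (r i + 1) → ℂ))
    (hφ : ∀ i, IsNondegenerateEmbedding (φ i)) (p : C) :
    -- part (1)
    List.TFAE
      [((fibre φ p \ ⋃ i, face φ p i) ∩ inflectionalLocus n (scroll φ)).Nonempty,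
        ∀ i, IsFlex φ p i,
        fibre φ p ⊆ inflectionalLocus n (scroll φ)] ∧
    -- part (2)
    (∀ i, vertex φ p i ∈ inflectionalLocus n (scroll φ) ↔ IsFlex φ p i) ∧
    -- part (3)
    (∀ s, ∀ x ∈ inflectionalLocus n (scroll φ), x ∈ fibre φ p \ face φ p s → IsFlex φ p s) := by
  have part3 : ∀ s, ∀ x ∈ inflectionalLocus n (scroll φ), x ∈ fibre φ p \ face φ p s →
      IsFlex φ p s := by
    intro s x hx hxp
    induction x using Projectivization.ind with
    | h v hv =>
      obtain ⟨hvp, hvs⟩ := hxp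
      rw [mk_mem_fibre_iff] at hvp
      rw [mk_mem_face_iff hv hvp] at hvs
      exact (mk_mem_inflectionalLocus_scroll_iff hφ hv hvp).mp hx s hvs
  refine ⟨?_, fun i => ?_, part3⟩
  · tfae_have 1 → 2 := by
      rintro ⟨x, ⟨hxp, hxf⟩, hx⟩ i
      exact part3 i x hx ⟨hxp, fun h => hxf (Set.mem_iUnion_of_mem i h)⟩
    tfae_have 2 → 3 := by
      intro h x hxp
      induction x using Projectivization.ind with
      | h v hv =>
        exact (mk_mem_inflectionalLocus_scroll_iff hφ hv ((mk_mem_fibre_iff hv).mp hxp)).mpr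
          fun j _ => h j
    tfae_have 3 → 1 := by
      intro h
      -- A point of the fibre with all coordinates nonzero lies on no face; `hn` makes the vector
      -- nonzero.
      have hv : (fun j => (φ j p).rep) ≠ 0 := fun h0 =>
        (φ ⟨0, hn⟩ p).rep_nonzero (congrFun h0 ⟨0, hn⟩)
      have hvp : ∀ j, (φ j p).rep ∈ (φ j p).submodule := fun j => by
        rw [Projectivization.submodule_eq]
        exact Submodule.mem_span_singleton_self _
      have hmem := (mk_mem_fibre_iff (φ := φ) hv).mpr hvp
      refine ⟨Projectivization.mk ℂ _ hv, ⟨hmem, fun hface => ?_⟩, h hmem⟩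
      obtain ⟨i, hi⟩ := Set.mem_iUnion.mp hface
      exact (φ i p).rep_nonzero ((mk_mem_face_iff hv hvp i).mp hi)
    tfae_finish
  · obtain ⟨w, hw0, hw, hw', hwv⟩ := exists_vertex_eq_mk (φ := φ) p i
    rw [hwv, mk_mem_inflectionalLocus_scroll_iff hφ hw' (single_mem_submodule hw)]
    refine ⟨fun h => h i (by simpa using hw0), fun h j hj => ?_⟩
    by_cases hji : j = i
    · rwa [hji]
    · exact (hj (by simp [hji])).elim
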